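/- Lemma 5.21. Let $n,\ell$ be integers with $2\le \ell<n-2$, let $C_1^+,C_2^+,C_3^+>0$ and $C_p>0$, and let $\bar C>C_p^{1/\ell}$ and $\bar c>0$. For real numbers $\varpi_1,\varpi_2<0$ with $\frac1{C_p}|\varpi_1|\le|\varpi_2|\le C_p|\varpi_1|$ and a point $\mathbf q_2\in\mathbb R^n\setminus\{0\}$ put $\gamma=|\mathbf q_2|$ and, for $\mathbf P=(\lambda_1,\lambda_2;\xi_1,\xi_2)\in(\mathbb R^+\times\mathbb R^+)\times(\mathbb R^n\times\mathbb R^n)$, put $\lambda=\sqrt{\lambda_1\lambda_2}$ and $\mathbf D=\gamma/\lambda$. Let $\mathcal T:(\mathbb R^+)^2\times(\mathbb R^n)^2\to\mathbb R^{2(n+1)}$, $\mathcal T=(T_{1_o},T_{2_o};T_{1_1},\dots,T_{1_n};T_{2_1},\dots,T_{2_n})$, be the map $$T_{1_o}=C_1^+|\varpi_1|\lambda_1^\ell-\frac{\lambda^{n-2}}{\gamma^{n-2}},\qquad T_{2_o}=C_1^+|\varpi_2|\lambda_2^\ell-\frac{\lambda^{n-2}}{\gamma^{n-2}},$$ $$T_{1_j}=C_2^+\varpi_1\lambda_1^\ell\,\frac{\xi_{1_j}}{\lambda_1}+\frac{C_3^+}{\lambda_2}\frac{\lambda^n}{\gamma^n}(\xi_{1_j}-\xi_{2_j}),\qquad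 T_{2_j}=C_2^+\varpi_2\lambda_2^\ell\,\frac{\xi_{2_j}-\mathbf q_{2_j}}{\lambda_2}+\frac{C_3^+}{\lambda_1}\frac{\lambda^n}{\gamma^n}(\xi_{2_j}-\xi_{1_j})\qquad(1\le j\le n).$$ Let $$\alpha=\Big(\frac{\varpi_1}{\varpi_2}\Big)^{1/\ell},\quad \lambda_{1_\tau}=\Big[\gamma^{n-2}\,\frac{C_1^+|\varpi_1|}{\alpha^{(n-2)/2}}\Big]^{\frac1{(n-2)-\ell}},\quad \lambda_{2_\tau}=\alpha\lambda_{1_\tau},\quad \lambda_\tau=\sqrt{\lambda_{1_\tau}\lambda_{2_\tau}},\quad \mathbf D_\tau=\frac{\gamma}{\lambda_\tau},\quad \beta=\alpha^{-2},$$ and let $\mathbf P_\tau=(\lambda_{1_\tau},\lambda_{2_\tau};\xi_{1_\tau},\xi_{2_\tau})$, where $$\xi_{1_\tau}\Big\{\frac{C_2^+}{C_1^+}-\frac{C_3^+}{\mathbf D_\tau^2\,\alpha}\Big(1+\frac1\beta\Big)\Big\}=-\frac{C_3^+}{\mathbf D_\tau^2\,\alpha}\,\mathbf q_2,\qquad \xi_{2_\tau}=\mathbf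 q_2-\frac1\beta\,\xi_{1_\tau}.$$ Then there are positive constants $\bar D,\mu_0,c,K$, depending only on $n,\ell,C_1^+,C_2^+,C_3^+,C_p,\bar C,\bar c$, such that for all $\varpi_1,\varpi_2,\mathbf q_2$ as above with $\mathbf D_\tau\ge\bar D$: (a) $\mathbf P_\tau$ is well defined and is the unique point of $(\mathbb R^+)^2\times(\mathbb R^n)^2$ with $\mathcal T(\mathbf P_\tau)=\vec 0$. (b) For every $\mu\in(0,\mu_0]$ the closed Euclidean ball $\overline{B_{\mathbf P_\tau}(\mu\lambda_{1_\tau})}$ lies in $(\mathbb R^+)^2\times(\mathbb R^n)^2$, the Brouwer degree satisfies $$\mathrm{Deg}\big(\mathcal T,B_{\mathbf P_\tau}(\mu\lambda_{1_\tau}),\vec 0\big)=-1,$$ and, with $\tilde c=c\,\mu\,|\varpi_1|$, every $\mathbf P\in\partial B_{\mathbf P_\tau}(\mu\lambda_{1_\tau})$ satisfies $\|\mathcal T(\mathbf P)\|\ge\tilde c\,\lambda_\tau^\ell$ and $\|\mathcal T(\mathbf P)\|\ge\tilde c\,\lambda^\ell$. (c) For every $\mu\in(0,\mu_0]$, all $\mathbf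 P\in \overline{B_{\mathbf P_\tau}(\mu\lambda_{1_\tau})}$ satisfy condition (2.12), $$\bar C^{-1}\lambda_2<\lambda_1<\bar C\lambda_2,\qquad |\xi_1|<\bar c\,\lambda,\qquad|\xi_2-\mathbf q_2|<\bar c\,\lambda,$$ and condition (3.45), $$\lambda^\ell\le\frac{C_o}{\mathbf D^{\,n-2}}\quad\text{with}\quad C_o=\frac{K}{|\varpi_1|},\qquad 2\le\ell<n-2.$$ -/

import Mathlib

noncomputable section

namespace TwinPeaks

/-! ### Brouwer degree

The construction is the usual one in two stages.  For a map that is `C¹` in the open set and has `y` as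
a regular value, the degree is the sum of the signs of the Jacobian determinants over the preimages of
`y`.  For a map that is merely continuous (or has `y` as a critical value), it is the common value of
that sum for all regular `C¹` maps that are uniformly close enough to the given one. -/

section Degree

variable {E : Type*} [NormedAddCommGroup E] [NormedSpace ℝ E]

/-- The triples `(f, Ω, y)` for which the degree is defined: `Ω` is open and bounded, `f` is continuous
on the closure of `Ω` and does not take the value `y` on the boundary of `Ω`. -/
def DegreeAdmissible (f : E → E) (Ω : Set E) (y : E) : Prop :=
  IsOpen Ω ∧ Bornology.IsBounded Ω ∧ ContinuousOn f (closure Ω) ∧ ∀ x ∈ frontier Ω, f x ≠ y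

/-- `f` is of class `C¹` in `Ω`, and `y` is a regular value of the restriction of `f` to `Ω`. -/
def RegularIn (f : E → E) (Ω : Set E) (y : E) : Prop :=
  ContDiffOn ℝ 1 f Ω ∧ ∀ x ∈ Ω, f x = y → (fderiv ℝ f x).det ≠ 0

/-- The sum of the signs of the Jacobian determinants over the preimages of `y` in `Ω`
(a finite set if `(f, Ω, y)` is admissible and regular). -/
def signedCount (f : E → E) (Ω : Set E) (y : E) : ℤ :=
  ∑ᶠ x ∈ {x : E | x ∈ Ω ∧ f x = y}, ((SignType.sign (fderiv ℝ f x).det : SignType) : ℤ)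

/-- `d` is the signed count of every regular admissible map that is uniformly close enough to `f`. -/
def IsApproxDegree (f : E → E) (Ω : Set E) (y : E) (d : ℤ) : Prop :=
  ∃ ε > 0, ∀ g : E → E, DegreeAdmissible g Ω y → RegularIn g Ω y →
    (∀ x ∈ closure Ω, ‖f x - g x‖ < ε) → signedCount g Ω y = d

open Classical in
/-- The Brouwer degree `Deg(f, Ω, y)`, with the value `0` for triples that are not admissible. -/
def brouwerDegree (f : E → E) (Ω : Set E) (y : E) : ℤ :=
  if DegreeAdmissible f Ω y then
    if RegularIn f Ω y then signedCount f Ω y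
    else Classical.epsilon (IsApproxDegree f Ω y)
  else 0

end Degree

/-! ### The parameter space and the model map -/

/-- `ℝ^{2(n+1)}` with the Euclidean norm.  The coordinates `Sum.inl 0`, `Sum.inl 1` are `λ₁`, `λ₂`
(or `T_{1_o}`, `T_{2_o}`), and `Sum.inr (0, j)`, `Sum.inr (1, j)` are `ξ_{1_j}`, `ξ_{2_j}`
(or `T_{1_j}`, `T_{2_j}`). -/
abbrev Param (n : ℕ) : Type := EuclideanSpace ℝ (Fin 2 ⊕ Fin 2 × Fin n)

/-- The point `(λ₁, λ₂; ξ₁, ξ₂)`. -/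
def Param.mk {n : ℕ} (l₁ l₂ : ℝ) (ξ₁ ξ₂ : EuclideanSpace ℝ (Fin n)) : Param n :=
  WithLp.toLp 2 (Sum.elim ![l₁, l₂] (fun p => (![ξ₁ p.2, ξ₂ p.2] : Fin 2 → ℝ) p.1))

/-- `λ₁` -/
def Param.lam₁ {n : ℕ} (P : Param n) : ℝ := P (Sum.inl 0)

/-- `λ₂` -/
def Param.lam₂ {n : ℕ} (P : Param n) : ℝ := P (Sum.inl 1)

/-- `ξ₁` -/
def Param.xi₁ {n : ℕ} (P : Param n) : EuclideanSpace ℝ (Fin n) :=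
  WithLp.toLp 2 (fun j => P (Sum.inr (0, j)))

/-- `ξ₂` -/
def Param.xi₂ {n : ℕ} (P : Param n) : EuclideanSpace ℝ (Fin n) :=
  WithLp.toLp 2 (fun j => P (Sum.inr (1, j)))

/-- `λ = √(λ₁ λ₂)` -/
def Param.lam {n : ℕ} (P : Param n) : ℝ := √(P.lam₁ * P.lam₂)

/-- The domain `(ℝ⁺ × ℝ⁺) × (ℝⁿ × ℝⁿ)`. -/
def domain (n : ℕ) : Set (Param n) := {P | 0 < P.lam₁ ∧ 0 < P.lam₂}

/-- The model map `𝒯`, with `γ = ‖q‖`; here `w₁`, `w₂` are the numbers `ϖ₁`, `ϖ₂`, and `q` is the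
point `q₂`. -/
def modelMap {n : ℕ} (ℓ : ℕ) (C₁ C₂ C₃ w₁ w₂ : ℝ) (q : EuclideanSpace ℝ (Fin n))
    (P : Param n) : Param n :=
  Param.mk
    (C₁ * |w₁| * P.lam₁ ^ ℓ - P.lam ^ (n - 2) / ‖q‖ ^ (n - 2))
    (C₁ * |w₂| * P.lam₂ ^ ℓ - P.lam ^ (n - 2) / ‖q‖ ^ (n - 2))
    (WithLp.toLp 2 fun j => C₂ * w₁ * P.lam₁ ^ ℓ * (P.xi₁ j / P.lam₁)
      + C₃ * (1 / P.lam₂) * (P.lam ^ n / ‖q‖ ^ n) * (P.xi₁ j - P.xi₂ j))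
    (WithLp.toLp 2 fun j => C₂ * w₂ * P.lam₂ ^ ℓ * ((P.xi₂ j - q j) / P.lam₂)
      + C₃ * (1 / P.lam₁) * (P.lam ^ n / ‖q‖ ^ n) * (P.xi₂ j - P.xi₁ j))

/-! ### The point `P_τ` -/

/-- `α = (ϖ₁ / ϖ₂)^{1/ℓ}` -/
def alpha (ℓ : ℕ) (w₁ w₂ : ℝ) : ℝ := (w₁ / w₂) ^ (1 / (ℓ : ℝ))

/-- `λ_{1τ} = [γ^{n-2} C₁ |ϖ₁| / α^{(n-2)/2}]^{1/((n-2)-ℓ)}` -/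
def lamTau₁ {n : ℕ} (ℓ : ℕ) (C₁ w₁ w₂ : ℝ) (q : EuclideanSpace ℝ (Fin n)) : ℝ :=
  (‖q‖ ^ (n - 2) * (C₁ * |w₁| / alpha ℓ w₁ w₂ ^ (((n : ℝ) - 2) / 2))) ^
    (1 / (((n : ℝ) - 2) - (ℓ : ℝ)))

/-- `λ_{2τ} = α λ_{1τ}` -/
def lamTau₂ {n : ℕ} (ℓ : ℕ) (C₁ w₁ w₂ : ℝ) (q : EuclideanSpace ℝ (Fin n)) : ℝ :=
  alpha ℓ w₁ w₂ * lamTau₁ ℓ C₁ w₁ w₂ q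

/-- `λ_τ = √(λ_{1τ} λ_{2τ})` -/
def lamTau {n : ℕ} (ℓ : ℕ) (C₁ w₁ w₂ : ℝ) (q : EuclideanSpace ℝ (Fin n)) : ℝ :=
  √(lamTau₁ ℓ C₁ w₁ w₂ q * lamTau₂ ℓ C₁ w₁ w₂ q)

/-- `D_τ = γ / λ_τ` -/
def DTau {n : ℕ} (ℓ : ℕ) (C₁ w₁ w₂ : ℝ) (q : EuclideanSpace ℝ (Fin n)) : ℝ :=
  ‖q‖ / lamTau ℓ C₁ w₁ w₂ q

/-- The positive number `β` with `ϖ₁ λ_{1τ}^ℓ (λ_{2τ}/λ_{1τ}) β = ϖ₂ λ_{2τ}^ℓ (λ_{1τ}/λ_{2τ})`;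
as `ϖ₁ λ_{1τ}^ℓ = ϖ₂ λ_{2τ}^ℓ`, it is `(λ_{1τ}/λ_{2τ})² = α⁻²`. -/
def beta (ℓ : ℕ) (w₁ w₂ : ℝ) : ℝ := (alpha ℓ w₁ w₂ ^ 2)⁻¹

/-- `ξ_{1τ}`, the solution of
`ξ_{1τ} {C₂/C₁ - C₃ D_τ⁻² α⁻¹ (1 + β⁻¹)} = - C₃ D_τ⁻² α⁻¹ q₂`. -/
def xiTau₁ {n : ℕ} (ℓ : ℕ) (C₁ C₂ C₃ w₁ w₂ : ℝ) (q : EuclideanSpace ℝ (Fin n)) :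
    EuclideanSpace ℝ (Fin n) :=
  (-(C₃ * (1 / DTau ℓ C₁ w₁ w₂ q ^ 2) * (1 / alpha ℓ w₁ w₂)) /
    (C₂ / C₁ - C₃ * (1 / DTau ℓ C₁ w₁ w₂ q ^ 2) * (1 / alpha ℓ w₁ w₂) *
      (1 + 1 / beta ℓ w₁ w₂))) • q

/-- `ξ_{2τ}`, given by `ξ_{1τ} = - β (ξ_{2τ} - q₂)`. -/
def xiTau₂ {n : ℕ} (ℓ : ℕ) (C₁ C₂ C₃ w₁ w₂ : ℝ) (q : EuclideanSpace ℝ (Fin n)) :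
    EuclideanSpace ℝ (Fin n) :=
  q - (1 / beta ℓ w₁ w₂) • xiTau₁ ℓ C₁ C₂ C₃ w₁ w₂ q

/-- `P_τ = (λ_{1τ}, λ_{2τ}; ξ_{1τ}, ξ_{2τ})` -/
def PTau {n : ℕ} (ℓ : ℕ) (C₁ C₂ C₃ w₁ w₂ : ℝ) (q : EuclideanSpace ℝ (Fin n)) : Param n :=
  Param.mk (lamTau₁ ℓ C₁ w₁ w₂ q) (lamTau₂ ℓ C₁ w₁ w₂ q)
    (xiTau₁ ℓ C₁ C₂ C₃ w₁ w₂ q) (xiTau₂ ℓ C₁ C₂ C₃ w₁ w₂ q)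

/-! ### The two conditions on the parameters -/

/-- Comparable scales, and centres close to `0` and `q₂`:
`C̄⁻¹ λ₂ < λ₁ < C̄ λ₂`, `|ξ₁| < c̄ λ`, `|ξ₂ - q₂| < c̄ λ`. -/
def ScaleCondition {n : ℕ} (Cbar cbar : ℝ) (q : EuclideanSpace ℝ (Fin n)) (P : Param n) : Prop :=
  Cbar⁻¹ * P.lam₂ < P.lam₁ ∧ P.lam₁ < Cbar * P.lam₂ ∧
    ‖P.xi₁‖ < cbar * P.lam ∧ ‖P.xi₂ - q‖ < cbar * P.lam

/-- `λ^ℓ ≤ C_o / D^{n-2}` with `D = γ / λ`, and `2 ≤ ℓ < n - 2`. -/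
def FlatnessCondition {n : ℕ} (ℓ : ℕ) (Co : ℝ) (q : EuclideanSpace ℝ (Fin n)) (P : Param n) :
    Prop :=
  P.lam ^ ℓ ≤ Co / (‖q‖ / P.lam) ^ (n - 2) ∧ 2 ≤ ℓ ∧ (ℓ : ℤ) < (n : ℤ) - 2

end TwinPeaks

end

noncomputable section

namespace TwinPeaks

/-! ### Scalar and vector estimates in rescaled variables -/

/-! Measure `λ₁`, `λ₂` in the units `l = λ_{1τ}` and `α l`, and the displacements of the centres
from those of `P_τ` in the unit `l`. In these variables `x₁, x₂, y₁, y₂` the model map is `E = C₁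
|ϖ₁| l^ℓ` times `scaledMap` (`Scaling.modelMap_eq`), which sees the data only through `a = C₂ / C₁`,
`α`, the coupling `κ = C₃ / (D_τ² α)` and `η = ξ_{1τ} / l`. The ratio `α` stays between `Cp^{-1/ℓ}`
and `Cp^{1/ℓ}`, and `κ`, `η` are uniformly small when `D_τ` is large (`exists_scaling`), so
estimates on `scaledMap` are uniform in the data.

With `s = √(x₁ x₂)`, the scalar components are `x_i^ℓ - s^{n-2}` and do not involve `y`. Their
vanishing forces `x₁ = x₂ = s` and then `s = 1`, because `ℓ < n - 2`; quantitatively they control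
`|x_i - 1|`. The vector components are affine in `y`: a nearly diagonal linear part, plus a multiple
of `η` that is `O(|x₁ - 1| + |x₂ - 1|)`. Hence the distance to `(1, 1, 0, 0)` is at most a constant
times the norm of `scaledMap` (`exists_le_norm_scaledMap`). This yields the bounds on the sphere and
the uniqueness of `y`; the scalar argument alone fixes `x` on the whole domain.

At `P_τ` the Jacobian matrix is block triangular. The `λ` block has the sign of `ℓ - (n - 2)`, which
is negative, and the `ξ` block is a 2×2 matrix of positive determinant tensored with the identity
(`Scaling.det_fderiv`). The single zero therefore contributes `-1` to the degree. -/

lemma abs_sub_mul_pow_le {x y r : ℝ} (hr : 0 ≤ r) (hx : r ≤ x) (hy : r ≤ y) (k : ℕ) :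
    r ^ k * |x - y| ≤ |x ^ (k + 1) - y ^ (k + 1)| := by
  wlog h : y ≤ x generalizing x y
  · rw [abs_sub_comm, abs_sub_comm (x ^ _)]
    exact this hy hx (le_of_not_ge h)
  have hy0 : 0 ≤ y := hr.trans hy
  have h1 : y ^ k ≤ x ^ k := pow_le_pow_left₀ hy0 h k
  have h2 : r ^ k ≤ x ^ k := pow_le_pow_left₀ hr hx k
  rw [abs_of_nonneg (sub_nonneg.2 h),
    abs_of_nonneg (sub_nonneg.2 (pow_le_pow_left₀ hy0 h (k + 1)))]
  have h3 : r ^ k * (x - y) ≤ x ^ k * (x - y) :=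
    mul_le_mul_of_nonneg_right h2 (sub_nonneg.2 h)
  have h4 : y ^ k * y ≤ x ^ k * y := mul_le_mul_of_nonneg_right h1 hy0
  rw [pow_succ, pow_succ]
  linarith

lemma abs_pow_sub_one_le {x : ℝ} (hx : 0 ≤ x) (hx2 : x ≤ 2) (k : ℕ) :
    |x ^ k - 1| ≤ k * 2 ^ k * |x - 1| := by
  induction k with
  | zero => simp
  | succ k ih =>
    have h : x ^ (k + 1) - 1 = x * (x ^ k - 1) + (x - 1) := by ring
    have h1 : |x * (x ^ k - 1)| ≤ 2 * (k * 2 ^ k * |x - 1|) := by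
      rw [abs_mul, abs_of_nonneg hx]
      exact mul_le_mul hx2 ih (abs_nonneg _) zero_le_two
    have h2 : (1 : ℝ) ≤ 2 ^ (k + 1) := one_le_pow₀ one_le_two
    have h3 : |x - 1| ≤ 2 ^ (k + 1) * |x - 1| := le_mul_of_one_le_left (abs_nonneg _) h2
    rw [h]
    calc _ ≤ _ := abs_add_le _ _
      _ ≤ 2 * (k * 2 ^ k * |x - 1|) + 2 ^ (k + 1) * |x - 1| := add_le_add h1 h3
      _ = _ := by push_cast; ring

lemma min_le_sqrt_mul {x y : ℝ} (hx : 0 ≤ x) (hy : 0 ≤ y) : min x y ≤ √(x * y) := by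
  apply Real.le_sqrt_of_sq_le
  rw [sq]
  exact mul_le_mul (min_le_left _ _) (min_le_right _ _) (le_min hx hy) hx

lemma sqrt_mul_le_max {x y : ℝ} (hx : 0 ≤ x) (hy : 0 ≤ y) : √(x * y) ≤ max x y := by
  refine Real.sqrt_le_iff.2 ⟨hx.trans (le_max_left _ _), ?_⟩
  rw [sq]
  exact mul_le_mul (le_max_left _ _) (le_max_right _ _) hy (hx.trans (le_max_left _ _))

lemma abs_sqrt_mul_sub_one_le {x y : ℝ} (hx : 0 ≤ x) (hy : 0 ≤ y) :
    |√(x * y) - 1| ≤ |x - 1| + |y - 1| := by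
  have h1 := min_le_sqrt_mul hx hy
  have h2 := sqrt_mul_le_max hx hy
  have := neg_abs_le (x - 1)
  have := neg_abs_le (y - 1)
  have := le_abs_self (x - 1)
  have := le_abs_self (y - 1)
  rw [abs_le]
  constructor
  · rcases min_choice x y with h | h <;> rw [h] at h1 <;> linarith
  · rcases max_choice x y with h | h <;> rw [h] at h2 <;> linarith

/-- As `√(x y)` lies between `x` and `y`, the number `√(x y)^ℓ - √(x y)^m` lies between the numbers
`x^ℓ - √(x y)^m` and `y^ℓ - √(x y)^m`. -/
lemma abs_sqrt_pow_sub_le {x y : ℝ} (hx : 0 ≤ x) (hy : 0 ≤ y) (ℓ m : ℕ) :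
    |√(x * y) ^ ℓ - √(x * y) ^ m| ≤ |x ^ ℓ - √(x * y) ^ m| + |y ^ ℓ - √(x * y) ^ m| := by
  have h1 := pow_le_pow_left₀ (le_min hx hy) (min_le_sqrt_mul hx hy) ℓ
  have h2 := pow_le_pow_left₀ (Real.sqrt_nonneg _) (sqrt_mul_le_max hx hy) ℓ
  set f := x ^ ℓ - √(x * y) ^ m with hf
  set g := y ^ ℓ - √(x * y) ^ m with hg
  have := neg_abs_le f
  have := neg_abs_le g
  have := le_abs_self f
  have := le_abs_self g
  rw [abs_le]
  constructor
  · rcases min_choice x y with h | h <;> rw [h] at h1 <;> linarith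
  · rcases max_choice x y with h | h <;> rw [h] at h2 <;> linarith

/-- Since `s = √(x y)` lies between `x` and `y`, `|x - 1| ≤ |x - y| + |s - 1|`. The difference of
the two quantities on the right controls `|x - y|`; their size also bounds `s^(k+1) - s^m`, which
controls `|s - 1|`. -/
lemma abs_sub_one_le_of_pow_diff {x y r : ℝ} (hr : 0 < r) (hr1 : r ≤ 1) (hx : r ≤ x) (hy : r ≤ y)
    {k m : ℕ} (hm : k + 1 < m) :
    |x - 1| ≤ 2 * (r⁻¹) ^ (k + 1) *
      (|x ^ (k + 1) - √(x * y) ^ m| + |y ^ (k + 1) - √(x * y) ^ m|) := by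
  have hx0 : 0 ≤ x := hr.le.trans hx
  have hy0 : 0 ≤ y := hr.le.trans hy
  have hs : r ≤ √(x * y) := (le_min hx hy).trans (min_le_sqrt_mul hx0 hy0)
  have hmin := min_le_sqrt_mul hx0 hy0
  have hmax := sqrt_mul_le_max hx0 hy0
  have h1 := abs_sqrt_pow_sub_le hx0 hy0 (k + 1) m
  have h2 := abs_sub_mul_pow_le hr.le hx hy k
  have h4 : |x ^ (k + 1) - y ^ (k + 1)| ≤
      |x ^ (k + 1) - √(x * y) ^ m| + |y ^ (k + 1) - √(x * y) ^ m| := by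
    rw [abs_sub_comm (y ^ (k + 1))]
    exact abs_sub_le _ _ _
  set F := |x ^ (k + 1) - √(x * y) ^ m| + |y ^ (k + 1) - √(x * y) ^ m|
  set s := √(x * y)
  -- The strict inequality of exponents leaves a factor `1 - s^(j+1)` with positive exponent, and
  -- `|s^(j+1) - 1| ≥ |s - 1|` for `s ≥ 0`.
  obtain ⟨j, rfl⟩ : ∃ j, m = k + 1 + (j + 1) := ⟨m - (k + 2), by omega⟩
  have h5 : r ^ (k + 1) * |s - 1| ≤ F := by
    refine le_trans ?_ h1
    have e : s ^ (k + 1) - s ^ (k + 1 + (j + 1)) = s ^ (k + 1) * (1 - s ^ (j + 1)) := by ring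
    rw [e, abs_mul, abs_of_nonneg (pow_nonneg (hr.le.trans hs) _)]
    refine mul_le_mul (pow_le_pow_left₀ hr.le hs _) ?_ (abs_nonneg _)
      (pow_nonneg (hr.le.trans hs) _)
    rw [abs_sub_comm 1 (s ^ (j + 1))]
    rcases le_total s 1 with h | h
    · rw [abs_of_nonpos (by linarith), abs_of_nonpos
        (by linarith [pow_le_one₀ (n := j + 1) (hr.le.trans hs) h])]
      have : s ^ (j + 1) ≤ s := pow_le_of_le_one (hr.le.trans hs) h (by omega)
      linarith
    · have : s ≤ s ^ (j + 1) := le_self_pow₀ h (by omega)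
      rw [abs_of_nonneg (by linarith), abs_of_nonneg (by linarith)]
      linarith
  have h6 : r ^ (k + 1) * |x - y| ≤ F :=
    le_trans (mul_le_mul_of_nonneg_right (pow_le_pow_of_le_one hr.le hr1 (Nat.le_succ k))
      (abs_nonneg _)) (h2.trans h4)
  have h7 : |x - 1| ≤ |x - y| + |s - 1| := by
    have := neg_abs_le (x - y)
    have := le_abs_self (x - y)
    have := neg_abs_le (s - 1)
    have := le_abs_self (s - 1)
    rw [abs_le]
    constructor
    · rcases max_choice x y with h | h <;> rw [h] at hmax <;> linarith
    · rcases min_choice x y with h | h <;> rw [h] at hmin <;> linarith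
  have hp : 0 < r ^ (k + 1) := pow_pos hr _
  rw [inv_pow, mul_assoc, mul_comm, mul_assoc]
  rw [← div_eq_inv_mul, le_div_iff₀ hp] at *
  all_goals nlinarith

/-- Both terms equal `1` at `x = y = 1`. After division by `y` this bounds the coefficient of `η` in
the vector components of `scaledMap`. -/
lemma abs_sqrt_pow_sub_mul_le {x y : ℝ} (hx : 0 ≤ x) (hy : 0 ≤ y) (hx2 : x ≤ 2) (hy2 : y ≤ 2)
    (n k : ℕ) :
    |√(x * y) ^ n - y * x ^ k| ≤ ((n * 2 ^ n + (k + 1) * 2 ^ k : ℝ)) * (|x - 1| + |y - 1|) := by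
  have hs2 : √(x * y) ≤ 2 := (sqrt_mul_le_max hx hy).trans (max_le hx2 hy2)
  have h1 := abs_pow_sub_one_le (Real.sqrt_nonneg (x * y)) hs2 n
  have h2 := abs_pow_sub_one_le hx hx2 k
  have h3 := abs_sqrt_mul_sub_one_le hx hy
  have h4 : |(y - 1) * x ^ k| ≤ 2 ^ k * |y - 1| := by
    rw [abs_mul, abs_of_nonneg (pow_nonneg hx k), mul_comm]
    exact mul_le_mul_of_nonneg_right (pow_le_pow_left₀ hx hx2 k) (abs_nonneg _)
  have e : √(x * y) ^ n - y * x ^ k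
      = (√(x * y) ^ n - 1) - ((y - 1) * x ^ k + (x ^ k - 1)) := by ring
  have h5 : (n * 2 ^ n : ℝ) * |√(x * y) - 1| ≤ n * 2 ^ n * (|x - 1| + |y - 1|) :=
    mul_le_mul_of_nonneg_left h3 (by positivity)
  rw [e]
  have h6 : (0:ℝ) ≤ 2 ^ k * |x - 1| := by positivity
  have h7 : (0:ℝ) ≤ k * 2 ^ k * |y - 1| := by positivity
  calc _ ≤ |√(x * y) ^ n - 1| + (|(y - 1) * x ^ k| + |x ^ k - 1|) :=
        (abs_sub _ _).trans (by gcongr; exact abs_add_le _ _)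
    _ ≤ _ := by linarith

/-! ### The model map in rescaled variables -/

/-- If `a p • y = -G + κ p₁ • (y - z) + a (p₁ - p) • η`, then `y` is controlled by `G`, up to small
multiples of `y`, `z` and `η`. -/
lemma norm_le_of_perturbed {V : Type*} [NormedAddCommGroup V] [NormedSpace ℝ V]
    {a κ p p₁ r M d : ℝ} {y z η G : V} (ha : 0 < a) (hκ : 0 ≤ κ) (hr : 0 < r) (hp : r ≤ p)
    (hp₁ : 0 ≤ p₁) (hp₁' : p₁ ≤ M) (hd : |p₁ - p| ≤ d)
    (hG : G = -(a * p) • y + (κ * p₁) • (y - z) + (a * (p₁ - p)) • η) :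
    r * a * ‖y‖ ≤ ‖G‖ + κ * M * (‖y‖ + ‖z‖) + a * d * ‖η‖ := by
  have e : (a * p) • y = -G + (κ * p₁) • (y - z) + (a * (p₁ - p)) • η := by
    rw [hG]; module
  have h0 : ‖(a * p) • y‖ = a * p * ‖y‖ := by
    rw [norm_smul, Real.norm_of_nonneg (mul_nonneg ha.le (hr.le.trans hp))]
  have h1 : ‖(κ * p₁) • (y - z)‖ ≤ κ * M * (‖y‖ + ‖z‖) := by
    rw [norm_smul, Real.norm_of_nonneg (mul_nonneg hκ hp₁)]
    exact mul_le_mul (mul_le_mul_of_nonneg_left hp₁' hκ) (norm_sub_le _ _) (norm_nonneg _)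
      (mul_nonneg hκ (hp₁.trans hp₁'))
  have h2 : ‖(a * (p₁ - p)) • η‖ ≤ a * d * ‖η‖ := by
    rw [norm_smul, Real.norm_eq_abs, abs_mul, abs_of_pos ha]
    exact mul_le_mul_of_nonneg_right (mul_le_mul_of_nonneg_left hd ha.le) (norm_nonneg _)
  have h3 : r * a * ‖y‖ ≤ a * p * ‖y‖ :=
    mul_le_mul_of_nonneg_right (by nlinarith) (norm_nonneg _)
  calc r * a * ‖y‖ ≤ ‖(a * p) • y‖ := h0 ▸ h3
    _ ≤ ‖-G‖ + ‖(κ * p₁) • (y - z)‖ + ‖(a * (p₁ - p)) • η‖ := e ▸ norm_add₃_le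
    _ ≤ _ := by rw [norm_neg]; linarith

section Param

variable {n : ℕ}

@[simp] lemma Param.lam₁_mk (a b : ℝ) (u v : EuclideanSpace ℝ (Fin n)) :
    (Param.mk a b u v).lam₁ = a := rfl

@[simp] lemma Param.lam₂_mk (a b : ℝ) (u v : EuclideanSpace ℝ (Fin n)) :
    (Param.mk a b u v).lam₂ = b := rfl

@[simp] lemma Param.xi₁_mk (a b : ℝ) (u v : EuclideanSpace ℝ (Fin n)) :
    (Param.mk a b u v).xi₁ = u := rfl

@[simp] lemma Param.xi₂_mk (a b : ℝ) (u v : EuclideanSpace ℝ (Fin n)) :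
    (Param.mk a b u v).xi₂ = v := rfl

lemma Param.mk_eta (P : Param n) : Param.mk P.lam₁ P.lam₂ P.xi₁ P.xi₂ = P := by
  ext i
  rcases i with i | ⟨i, j⟩ <;> fin_cases i <;> rfl

lemma Param.mk_sub_mk (a b a' b' : ℝ) (u v u' v' : EuclideanSpace ℝ (Fin n)) :
    Param.mk a b u v - Param.mk a' b' u' v' = Param.mk (a - a') (b - b') (u - u') (v - v') := by
  ext i
  rcases i with i | ⟨i, j⟩ <;> fin_cases i <;> rfl

lemma Param.mk_add_smul_mk (t a b a' b' : ℝ) (u v u' v' : EuclideanSpace ℝ (Fin n)) :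
    Param.mk a b u v + t • Param.mk a' b' u' v' =
      Param.mk (a + t * a') (b + t * b') (u + t • u') (v + t • v') := by
  ext i
  rcases i with i | ⟨i, j⟩ <;> fin_cases i <;> rfl

lemma Param.norm_sq_mk (a b : ℝ) (u v : EuclideanSpace ℝ (Fin n)) :
    ‖Param.mk a b u v‖ ^ 2 = a ^ 2 + b ^ 2 + ‖u‖ ^ 2 + ‖v‖ ^ 2 := by
  simp only [EuclideanSpace.norm_sq_eq, Fintype.sum_sum_type, Fintype.sum_prod_type,
    Fin.sum_univ_two, Real.norm_eq_abs, sq_abs, add_assoc]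
  rfl

lemma Param.mk_eq_zero_iff {a b : ℝ} {u v : EuclideanSpace ℝ (Fin n)} :
    Param.mk a b u v = 0 ↔ a = 0 ∧ b = 0 ∧ u = 0 ∧ v = 0 := by
  constructor
  · intro h
    have h' := Param.norm_sq_mk a b u v
    rw [h, norm_zero] at h'
    have := sq_nonneg a
    have := sq_nonneg b
    have := sq_nonneg ‖u‖
    have := sq_nonneg ‖v‖
    refine ⟨?_, ?_, ?_, ?_⟩
    · exact pow_eq_zero_iff two_ne_zero |>.1 (by linarith)
    · exact pow_eq_zero_iff two_ne_zero |>.1 (by linarith)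
    · exact norm_eq_zero.1 (pow_eq_zero_iff two_ne_zero |>.1 (by linarith))
    · exact norm_eq_zero.1 (pow_eq_zero_iff two_ne_zero |>.1 (by linarith))
  · rintro ⟨rfl, rfl, rfl, rfl⟩
    have := Param.norm_sq_mk (n := n) 0 0 0 0
    rw [norm_zero] at this
    exact norm_eq_zero.1 (pow_eq_zero_iff two_ne_zero |>.1 (by linarith))

lemma Param.abs_fst_le (a b : ℝ) (u v : EuclideanSpace ℝ (Fin n)) :
    |a| ≤ ‖Param.mk a b u v‖ := by
  rw [← Real.norm_eq_abs]
  exact PiLp.norm_apply_le (Param.mk a b u v) (Sum.inl 0)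

lemma Param.abs_snd_le (a b : ℝ) (u v : EuclideanSpace ℝ (Fin n)) :
    |b| ≤ ‖Param.mk a b u v‖ := by
  rw [← Real.norm_eq_abs]
  exact PiLp.norm_apply_le (Param.mk a b u v) (Sum.inl 1)

lemma Param.norm_xi₁_le (a b : ℝ) (u v : EuclideanSpace ℝ (Fin n)) :
    ‖u‖ ≤ ‖Param.mk a b u v‖ := by
  refine le_of_sq_le_sq ?_ (norm_nonneg _)
  rw [Param.norm_sq_mk]
  nlinarith [sq_nonneg a, sq_nonneg b, sq_nonneg ‖v‖]

lemma Param.norm_xi₂_le (a b : ℝ) (u v : EuclideanSpace ℝ (Fin n)) :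
    ‖v‖ ≤ ‖Param.mk a b u v‖ := by
  refine le_of_sq_le_sq ?_ (norm_nonneg _)
  rw [Param.norm_sq_mk]
  nlinarith [sq_nonneg a, sq_nonneg b, sq_nonneg ‖u‖]

lemma Param.norm_mk_le (a b : ℝ) (u v : EuclideanSpace ℝ (Fin n)) :
    ‖Param.mk a b u v‖ ≤ |a| + |b| + ‖u‖ + ‖v‖ := by
  refine le_of_sq_le_sq ?_ (by positivity)
  rw [Param.norm_sq_mk, ← sq_abs a, ← sq_abs b]
  have := abs_nonneg a
  have := abs_nonneg b
  have := norm_nonneg u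
  have := norm_nonneg v
  have h1 : 0 ≤ |a| * |b| := by positivity
  have h2 : 0 ≤ |a| * ‖u‖ := by positivity
  have h3 : 0 ≤ |a| * ‖v‖ := by positivity
  have h4 : 0 ≤ |b| * ‖u‖ := by positivity
  have h5 : 0 ≤ |b| * ‖v‖ := by positivity
  have h6 : 0 ≤ ‖u‖ * ‖v‖ := by positivity
  linarith [show (|a| + |b| + ‖u‖ + ‖v‖) ^ 2 = |a| ^ 2 + |b| ^ 2 + ‖u‖ ^ 2 + ‖v‖ ^ 2 +
    2 * (|a| * |b| + |a| * ‖u‖ + |a| * ‖v‖ + |b| * ‖u‖ + |b| * ‖v‖ + ‖u‖ * ‖v‖) by ring]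

/-- The model map after division by its natural size, in the variables `x₁ = λ₁ / l`,
`x₂ = λ₂ / (α l)`, `y_i = (ξ_i - ξ_{iτ}) / l`. -/
def scaledMap (k : ℕ) (a κ α : ℝ) (η : EuclideanSpace ℝ (Fin n)) (x₁ x₂ : ℝ)
    (y₁ y₂ : EuclideanSpace ℝ (Fin n)) : Param n :=
  Param.mk (x₁ ^ (k + 1) - √(x₁ * x₂) ^ (n - 2)) (x₂ ^ (k + 1) - √(x₁ * x₂) ^ (n - 2))
    (-(a * x₁ ^ k) • y₁ + (κ * (√(x₁ * x₂) ^ n / x₂)) • (y₁ - y₂)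
      + (a * (√(x₁ * x₂) ^ n / x₂ - x₁ ^ k)) • η)
    (-(a / α * x₂ ^ k) • y₂ + (α * κ * (√(x₁ * x₂) ^ n / x₁)) • (y₂ - y₁)
      + (a / α * (√(x₁ * x₂) ^ n / x₁ - x₂ ^ k)) • (-(α ^ 2) • η))

/-- The quantities attached to `P_τ` and the equations that they satisfy. -/
structure Scaling (k : ℕ) (C₁ C₂ C₃ w₁ w₂ : ℝ) (q : EuclideanSpace ℝ (Fin n))
    (l α E a κ : ℝ) (η : EuclideanSpace ℝ (Fin n)) : Prop where
  two_le : 2 ≤ n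
  l_pos : 0 < l
  α_pos : 0 < α
  E_pos : 0 < E
  q_ne : q ≠ 0
  w₁_eq : C₂ * w₁ * l ^ (k + 1) = -(a * E)
  w₂_eq : C₂ * w₂ * (α * l) ^ (k + 1) = -(a * E)
  abs_w₁_eq : C₁ * |w₁| * l ^ (k + 1) = E
  abs_w₂_eq : C₁ * |w₂| * (α * l) ^ (k + 1) = E
  pow_eq : (√α * l / ‖q‖) ^ (n - 2) = E
  sq_eq : C₃ * (√α * l / ‖q‖) ^ 2 = κ * α
  η_eq : (κ * (1 + α ^ 2)) • η = a • η + (κ / l) • q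

/-- Here `λ = √α l s`, so `pow_eq` and `sq_eq` turn the powers of `λ / γ` into `E` times powers of
`s`. The equation for `η` eliminates `q`: the terms free of `y` become a multiple of `η` that
vanishes at `x₁ = x₂ = 1`. -/
lemma Scaling.modelMap_eq {k : ℕ} {C₁ C₂ C₃ w₁ w₂ : ℝ} {q : EuclideanSpace ℝ (Fin n)}
    {l α E a κ : ℝ} {η : EuclideanSpace ℝ (Fin n)}
    (h : Scaling k C₁ C₂ C₃ w₁ w₂ q l α E a κ η) {x₁ x₂ : ℝ} (hx₁ : 0 < x₁) (hx₂ : 0 < x₂)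
    (y₁ y₂ : EuclideanSpace ℝ (Fin n)) :
    modelMap (k + 1) C₁ C₂ C₃ w₁ w₂ q (Param.mk (l * x₁) (α * l * x₂) (l • η + l • y₁)
      (q - (α ^ 2) • (l • η) + l • y₂)) = E • scaledMap k a κ α η x₁ x₂ y₁ y₂ := by
  obtain ⟨hn, hl, hα, hE, hq, hw₁, hw₂, hW₁, hW₂, hp, hs, hη⟩ := h
  have hq0 : 0 < ‖q‖ := norm_pos_iff.2 hq
  have hlam : √(l * x₁ * (α * l * x₂)) = √α * l * √(x₁ * x₂) := by
    rw [show l * x₁ * (α * l * x₂) = α * (l ^ 2 * (x₁ * x₂)) by ring, Real.sqrt_mul hα.le,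
      Real.sqrt_mul (sq_nonneg l), Real.sqrt_sq hl.le]
    ring
  have hm : (√α * l * √(x₁ * x₂)) ^ (n - 2) / ‖q‖ ^ (n - 2) = E * √(x₁ * x₂) ^ (n - 2) := by
    rw [← hp]; ring
  have hN : C₃ * ((√α * l * √(x₁ * x₂)) ^ n / ‖q‖ ^ n) = E * (κ * α) * √(x₁ * x₂) ^ n := by
    rw [← hp, ← hs]
    -- The exponent `n` splits as `(n - 2) + 2`, to which `pow_eq` and `sq_eq` apply separately.
    obtain ⟨m, rfl⟩ : ∃ m, n = m + 2 := ⟨n - 2, by omega⟩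
    rw [Nat.add_sub_cancel]
    ring
  have hηj : ∀ j, κ * (1 + α ^ 2) * η j = a * η j + κ / l * q j := fun j => by
    simpa using congrArg (fun v : EuclideanSpace ℝ (Fin n) => v j) hη
  set s := √(x₁ * x₂) with hsdef
  have hqj : ∀ j, κ * q j = l * (κ * (1 + α ^ 2) * η j - a * η j) := fun j => by
    rw [hηj]; field_simp; ring
  ext i
  rcases i with i | ⟨i, j⟩ <;> fin_cases i
  · change C₁ * |w₁| * (l * x₁) ^ (k + 1) - √(l * x₁ * (α * l * x₂)) ^ (n - 2) / ‖q‖ ^ (n - 2)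
      = E * (x₁ ^ (k + 1) - s ^ (n - 2))
    rw [hlam, hm]
    rw [mul_pow, ← mul_assoc, hW₁]; ring
  · change C₁ * |w₂| * (α * l * x₂) ^ (k + 1) - √(l * x₁ * (α * l * x₂)) ^ (n - 2) / ‖q‖ ^ (n - 2)
      = E * (x₂ ^ (k + 1) - s ^ (n - 2))
    rw [hlam, hm]
    rw [mul_pow, ← mul_assoc, hW₂]; ring
  · change C₂ * w₁ * (l * x₁) ^ (k + 1) * ((l * η j + l * y₁ j) / (l * x₁))
      + C₃ * (1 / (α * l * x₂)) * (√(l * x₁ * (α * l * x₂)) ^ n / ‖q‖ ^ n)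
        * ((l * η j + l * y₁ j) - (q j - α ^ 2 * (l * η j) + l * y₂ j))
      = E * (-(a * x₁ ^ k) * y₁ j + (κ * (s ^ n / x₂)) * (y₁ j - y₂ j)
      + (a * (s ^ n / x₂ - x₁ ^ k)) * η j)
    rw [hlam]
    have e1 : C₂ * w₁ * (l * x₁) ^ (k + 1) * ((l * η j + l * y₁ j) / (l * x₁))
        = -(a * E) * x₁ ^ k * (η j + y₁ j) := by
      rw [← hw₁]; field_simp; ring
    have e2 : C₃ * (1 / (α * l * x₂)) * ((√α * l * s) ^ n / ‖q‖ ^ n)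
        * ((l * η j + l * y₁ j) - (q j - α ^ 2 * (l * η j) + l * y₂ j))
        = E * (s ^ n / x₂) * (κ * (1 + α ^ 2) * η j - κ * q j / l + κ * (y₁ j - y₂ j)) := by
      rw [mul_right_comm C₃, hN]; field_simp; ring
    rw [e1, e2, hqj]; field_simp; ring
  · change C₂ * w₂ * (α * l * x₂) ^ (k + 1) *
        (((q j - α ^ 2 * (l * η j) + l * y₂ j) - q j) / (α * l * x₂))
      + C₃ * (1 / (l * x₁)) * (√(l * x₁ * (α * l * x₂)) ^ n / ‖q‖ ^ n)
        * ((q j - α ^ 2 * (l * η j) + l * y₂ j) - (l * η j + l * y₁ j))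
      = E * (-(a / α * x₂ ^ k) * y₂ j + (α * κ * (s ^ n / x₁)) * (y₂ j - y₁ j)
      + (a / α * (s ^ n / x₁ - x₂ ^ k)) * (-(α ^ 2) * η j))
    rw [hlam]
    have e1 : C₂ * w₂ * (α * l * x₂) ^ (k + 1) *
        (((q j - α ^ 2 * (l * η j) + l * y₂ j) - q j) / (α * l * x₂))
        = -(a * E) * x₂ ^ k / α * (y₂ j - α ^ 2 * η j) := by
      rw [← hw₂]; field_simp; ring
    have e2 : C₃ * (1 / (l * x₁)) * ((√α * l * s) ^ n / ‖q‖ ^ n)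
        * ((q j - α ^ 2 * (l * η j) + l * y₂ j) - (l * η j + l * y₁ j))
        = α * E * (s ^ n / x₁) * (κ * q j / l - κ * (1 + α ^ 2) * η j + κ * (y₂ j - y₁ j)) := by
      rw [mul_right_comm C₃, hN]; field_simp; ring
    rw [e1, e2, hqj]; field_simp; ring

end Param

/-! ### Smoothness of the model map and its Jacobian determinant at `P_τ` -/

section Jacobian

variable {n : ℕ}

lemma isOpen_domain : IsOpen (domain n) := by
  have h (i : Fin 2) : Continuous fun P : Param n => P (Sum.inl i) := by fun_prop
  exact (isOpen_lt continuous_const (h 0)).inter (isOpen_lt continuous_const (h 1))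

lemma contDiffOn_modelMap (ℓ : ℕ) (C₁ C₂ C₃ w₁ w₂ : ℝ) (q : EuclideanSpace ℝ (Fin n)) :
    ContDiffOn ℝ 1 (modelMap ℓ C₁ C₂ C₃ w₁ w₂ q) (domain n) := by
  have hc (i : Fin 2 ⊕ Fin 2 × Fin n) : ContDiffOn ℝ 1 (fun P : Param n => P i) (domain n) :=
    ContDiff.contDiffOn (by fun_prop)
  have h₁ : ContDiffOn ℝ 1 (fun P : Param n => P.lam₁) (domain n) := hc _
  have h₂ : ContDiffOn ℝ 1 (fun P : Param n => P.lam₂) (domain n) := hc _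
  have h₃ (j : Fin n) : ContDiffOn ℝ 1 (fun P : Param n => P.xi₁ j) (domain n) := hc _
  have h₄ (j : Fin n) : ContDiffOn ℝ 1 (fun P : Param n => P.xi₂ j) (domain n) := hc _
  have h₅ : ContDiffOn ℝ 1 (fun P : Param n => P.lam) (domain n) :=
    (h₁.mul h₂).sqrt fun P hP => (mul_pos hP.1 hP.2).ne'
  have n₁ : ∀ P ∈ domain n, P.lam₁ ≠ 0 := fun P hP => hP.1.ne'
  have n₂ : ∀ P ∈ domain n, P.lam₂ ≠ 0 := fun P hP => hP.2.ne'
  rw [contDiffOn_euclidean]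
  rintro (i | ⟨i, j⟩) <;> fin_cases i
  · exact (contDiffOn_const.mul (h₁.pow ℓ)).sub ((h₅.pow _).div_const _)
  · exact (contDiffOn_const.mul (h₂.pow ℓ)).sub ((h₅.pow _).div_const _)
  · exact ((contDiffOn_const.mul (h₁.pow ℓ)).mul ((h₃ j).div h₁ n₁)).add
      (((contDiffOn_const.mul (contDiffOn_const.div h₂ n₂)).mul ((h₅.pow n).div_const _)).mul
        ((h₃ j).sub (h₄ j)))
  · exact ((contDiffOn_const.mul (h₂.pow ℓ)).mul (((h₄ j).sub contDiffOn_const).div h₂ n₂)).add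
      (((contDiffOn_const.mul (contDiffOn_const.div h₁ n₁)).mul ((h₅.pow n).div_const _)).mul
        ((h₄ j).sub (h₃ j)))

lemma hasDerivAt_pow_sub_sqrt_pow (k m : ℕ) (b c : ℝ) :
    HasDerivAt (fun t : ℝ => (1 + t * b) ^ k - √((1 + t * b) * (1 + t * c)) ^ m)
      (k * b - m * ((b + c) / 2)) 0 := by
  have h (b : ℝ) : HasDerivAt (fun t : ℝ => 1 + t * b) b 0 := by
    simpa using ((hasDerivAt_id (0 : ℝ)).mul_const b).const_add 1
  have h2 : HasDerivAt (fun t : ℝ => √((1 + t * b) * (1 + t * c))) ((b + c) / 2) 0 := by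
    have := ((h b).mul (h c)).sqrt (by simp)
    simpa using this
  have h3 := ((h b).pow k).sub (h2.pow m)
  refine h3.congr_deriv ?_
  simp

/-- The point `P_τ` in terms of the data of a scaling. -/
def centre (q : EuclideanSpace ℝ (Fin n)) (l α : ℝ) (η : EuclideanSpace ℝ (Fin n)) : Param n :=
  Param.mk l (α * l) (l • η) (q - (α ^ 2) • (l • η))

lemma Scaling.centre_mem {k : ℕ} {C₁ C₂ C₃ w₁ w₂ : ℝ} {q : EuclideanSpace ℝ (Fin n)}
    {l α E a κ : ℝ} {η : EuclideanSpace ℝ (Fin n)}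
    (h : Scaling k C₁ C₂ C₃ w₁ w₂ q l α E a κ η) : centre q l α η ∈ domain n :=
  ⟨h.l_pos, mul_pos h.α_pos h.l_pos⟩

lemma Scaling.modelMap_line {k : ℕ} {C₁ C₂ C₃ w₁ w₂ : ℝ} {q : EuclideanSpace ℝ (Fin n)}
    {l α E a κ : ℝ} {η : EuclideanSpace ℝ (Fin n)}
    (h : Scaling k C₁ C₂ C₃ w₁ w₂ q l α E a κ η) (b c : ℝ) (u v : EuclideanSpace ℝ (Fin n)) :
    ∀ᶠ t in nhds (0 : ℝ), modelMap (k + 1) C₁ C₂ C₃ w₁ w₂ q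
      (centre q l α η + t • Param.mk b c u v) =
        E • scaledMap k a κ α η (1 + t * (b / l)) (1 + t * (c / (α * l)))
          ((t / l) • u) ((t / l) • v) := by
  have hl := h.l_pos
  have hα := h.α_pos
  have hpos (b : ℝ) : ∀ᶠ t in nhds (0 : ℝ), 0 < 1 + t * b := by
    have : ContinuousAt (fun t : ℝ => 1 + t * b) 0 := by fun_prop
    exact this.eventually (lt_mem_nhds (by simp))
  filter_upwards [hpos (b / l), hpos (c / (α * l))] with t h₁ h₂
  rw [← h.modelMap_eq h₁ h₂, centre, Param.mk_add_smul_mk, smul_smul l, smul_smul l,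
    mul_div_cancel₀ t hl.ne']
  congr 2
  · field_simp
  · field_simp

/-- Differentiability is already known from smoothness, so each entry of the Jacobian can be read
off from a one-variable derivative of the rescaled map along a line. -/
lemma Scaling.fderiv_apply {k : ℕ} {C₁ C₂ C₃ w₁ w₂ : ℝ} {q : EuclideanSpace ℝ (Fin n)}
    {l α E a κ : ℝ} {η : EuclideanSpace ℝ (Fin n)}
    (h : Scaling k C₁ C₂ C₃ w₁ w₂ q l α E a κ η) {b c : ℝ} {u v : EuclideanSpace ℝ (Fin n)}
    {i : Fin 2 ⊕ Fin 2 × Fin n} {d : ℝ}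
    (hd : HasDerivAt (fun t : ℝ => scaledMap k a κ α η (1 + t * (b / l)) (1 + t * (c / (α * l)))
          ((t / l) • u) ((t / l) • v) i) d 0) :
    fderiv ℝ (modelMap (k + 1) C₁ C₂ C₃ w₁ w₂ q) (centre q l α η) (Param.mk b c u v) i
      = E * d := by
  have h1 : HasFDerivAt (modelMap (k + 1) C₁ C₂ C₃ w₁ w₂ q) _ (centre q l α η) :=
    (((contDiffOn_modelMap (k + 1) C₁ C₂ C₃ w₁ w₂ q).contDiffAt
      (isOpen_domain.mem_nhds h.centre_mem)).differentiableAt one_ne_zero).hasFDerivAt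
  have h2 : HasDerivAt (fun t : ℝ => modelMap (k + 1) C₁ C₂ C₃ w₁ w₂ q
      (centre q l α η + t • Param.mk b c u v)) _ 0 := h1.hasLineDerivAt (Param.mk b c u v)
  have h3 := (EuclideanSpace.proj i : Param n →L[ℝ] ℝ).hasFDerivAt.comp_hasDerivAt 0 h2
  refine h3.unique ?_
  refine (hd.const_mul E).congr_of_eventuallyEq ?_
  filter_upwards [h.modelMap_line b c u v] with t ht
  exact congrArg (fun P : Param n => P i) ht

lemma Scaling.fderiv_inl {k : ℕ} {C₁ C₂ C₃ w₁ w₂ : ℝ} {q : EuclideanSpace ℝ (Fin n)}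
    {l α E a κ : ℝ} {η : EuclideanSpace ℝ (Fin n)}
    (h : Scaling k C₁ C₂ C₃ w₁ w₂ q l α E a κ η) (b c : ℝ) (u v : EuclideanSpace ℝ (Fin n)) :
    fderiv ℝ (modelMap (k + 1) C₁ C₂ C₃ w₁ w₂ q) (centre q l α η) (Param.mk b c u v) (Sum.inl 0)
      = E * ((k + 1) * (b / l) - ((n : ℝ) - 2) * ((b / l + c / (α * l)) / 2)) ∧
    fderiv ℝ (modelMap (k + 1) C₁ C₂ C₃ w₁ w₂ q) (centre q l α η) (Param.mk b c u v) (Sum.inl 1)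
      = E * ((k + 1) * (c / (α * l)) - ((n : ℝ) - 2) * ((b / l + c / (α * l)) / 2)) := by
  constructor
  · refine h.fderiv_apply ?_
    have := hasDerivAt_pow_sub_sqrt_pow (k + 1) (n - 2) (b / l) (c / (α * l))
    rw [Nat.cast_sub h.two_le] at this
    push_cast at this
    exact this
  · refine h.fderiv_apply ?_
    have := hasDerivAt_pow_sub_sqrt_pow (k + 1) (n - 2) (c / (α * l)) (b / l)
    rw [Nat.cast_sub h.two_le, add_comm (c / _)] at this
    push_cast at this
    refine this.congr_of_eventuallyEq (Filter.Eventually.of_forall fun t => ?_)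
    change _ - √_ ^ _ = _
    rw [mul_comm (1 + t * (b / l))]

/-- Only directions with fixed `λ₁`, `λ₂` are needed: the other entries of these rows lie in the
off-diagonal block that the triangular determinant ignores. -/
lemma Scaling.fderiv_inr {k : ℕ} {C₁ C₂ C₃ w₁ w₂ : ℝ} {q : EuclideanSpace ℝ (Fin n)}
    {l α E a κ : ℝ} {η : EuclideanSpace ℝ (Fin n)}
    (h : Scaling k C₁ C₂ C₃ w₁ w₂ q l α E a κ η) (u v : EuclideanSpace ℝ (Fin n)) (j : Fin n) :
    fderiv ℝ (modelMap (k + 1) C₁ C₂ C₃ w₁ w₂ q) (centre q l α η) (Param.mk 0 0 u v)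
      (Sum.inr (0, j)) = E / l * (-a * u j + κ * (u j - v j)) ∧
    fderiv ℝ (modelMap (k + 1) C₁ C₂ C₃ w₁ w₂ q) (centre q l α η) (Param.mk 0 0 u v)
      (Sum.inr (1, j)) = E / l * (-(a / α) * v j + α * κ * (v j - u j)) := by
  have hid (d : ℝ) : HasDerivAt (fun t : ℝ => t * d) d 0 := by
    simpa using (hasDerivAt_id (0 : ℝ)).mul_const d
  constructor
  · rw [div_mul_eq_mul_div, mul_div_assoc]
    refine h.fderiv_apply
      ((hid _).congr_of_eventuallyEq (Filter.Eventually.of_forall fun t => ?_))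
    change -(a * (1 + t * (0 / l)) ^ k) * (t / l * u j) + κ * _ * (t / l * u j - t / l * v j)
      + (a * _) * η j = _
    simp
    ring
  · rw [div_mul_eq_mul_div, mul_div_assoc]
    refine h.fderiv_apply
      ((hid _).congr_of_eventuallyEq (Filter.Eventually.of_forall fun t => ?_))
    change -(a / α * (1 + t * (0 / (α * l))) ^ k) * (t / l * v j)
      + α * κ * _ * (t / l * v j - t / l * u j) + (a / α * _) * (-(α ^ 2) * η j) = _
    simp
    ring

lemma single_inl_zero : (EuclideanSpace.single (Sum.inl 0) 1 : Param n) = Param.mk 1 0 0 0 := by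
  ext i
  rcases i with i | ⟨i, j⟩ <;> fin_cases i <;> simp [Param.mk]

lemma single_inl_one : (EuclideanSpace.single (Sum.inl 1) 1 : Param n) = Param.mk 0 1 0 0 := by
  ext i
  rcases i with i | ⟨i, j⟩ <;> fin_cases i <;> simp [Param.mk]

lemma single_inr_zero (j : Fin n) : (EuclideanSpace.single (Sum.inr (0, j)) 1 : Param n) =
    Param.mk 0 0 (EuclideanSpace.single j 1) 0 := by
  ext i
  rcases i with i | ⟨i, j⟩ <;> fin_cases i <;> simp [Param.mk]

lemma single_inr_one (j : Fin n) : (EuclideanSpace.single (Sum.inr (1, j)) 1 : Param n) =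
    Param.mk 0 0 0 (EuclideanSpace.single j 1) := by
  ext i
  rcases i with i | ⟨i, j⟩ <;> fin_cases i <;> simp [Param.mk]

open Matrix Kronecker in
-- The scalar rows do not depend on `ξ`, so the matrix is block lower triangular. The `ξ` block acts
-- identically on every coordinate `j`, hence is a Kronecker product with the identity, and its
-- determinant is an `n`-th power.
lemma Scaling.det_fderiv {k : ℕ} {C₁ C₂ C₃ w₁ w₂ : ℝ} {q : EuclideanSpace ℝ (Fin n)}
    {l α E a κ : ℝ} {η : EuclideanSpace ℝ (Fin n)}
    (h : Scaling k C₁ C₂ C₃ w₁ w₂ q l α E a κ η) :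
    (fderiv ℝ (modelMap (k + 1) C₁ C₂ C₃ w₁ w₂ q) (centre q l α η)).det =
      (E ^ 2 / (α * l ^ 2) * ((k + 1) * ((k + 1) - ((n : ℝ) - 2)))) *
        ((E / l) ^ 2 * (a / α) * (a - κ * (1 + α ^ 2))) ^ n := by
  have hl := h.l_pos
  have hα := h.α_pos
  set T := fderiv ℝ (modelMap (k + 1) C₁ C₂ C₃ w₁ w₂ q) (centre q l α η)
  set bas := (EuclideanSpace.basisFun (Fin 2 ⊕ Fin 2 × Fin n) ℝ).toBasis
  set J := LinearMap.toMatrix bas bas (T : Param n →ₗ[ℝ] Param n) with hJ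
  have hJ' (i i' : Fin 2 ⊕ Fin 2 × Fin n) : J i i' = T (EuclideanSpace.single i' 1) i := by
    simp [hJ, bas, LinearMap.toMatrix_apply]
  have hdet : T.det = J.det := (LinearMap.det_toMatrix bas _).symm
  have h11 : J.toBlocks₁₁ = E • !![(k + 1) / l - ((n : ℝ) - 2) / (2 * l), -((n : ℝ) - 2) / (2 * (α * l));
        -((n : ℝ) - 2) / (2 * l), (k + 1) / (α * l) - ((n : ℝ) - 2) / (2 * (α * l))] := by
    ext i i'
    rw [toBlocks₁₁, of_apply, hJ']
    fin_cases i <;> fin_cases i' <;>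
    simp only [Fin.zero_eta, Fin.mk_one, single_inl_zero, single_inl_one, T, h.fderiv_inl] <;>
    simp <;> (try left) <;> field_simp <;> ring
  have h12 : J.toBlocks₁₂ = 0 := by
    ext i ⟨i', j'⟩
    rw [toBlocks₁₂, of_apply, hJ']
    fin_cases i <;> fin_cases i' <;>
    simp only [Fin.zero_eta, Fin.mk_one, single_inr_zero, single_inr_one, T, h.fderiv_inl] <;>
    simp
  have h22 : J.toBlocks₂₂ = ((E / l) • !![-a + κ, -κ; -(α * κ), -(a / α) + α * κ]) ⊗ₖ
      (1 : Matrix (Fin n) (Fin n) ℝ) := by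
    ext ⟨i, j⟩ ⟨i', j'⟩
    rw [toBlocks₂₂, of_apply, hJ']
    fin_cases i <;> fin_cases i' <;>
    simp only [Fin.zero_eta, Fin.mk_one, single_inr_zero, single_inr_one, T, h.fderiv_inr] <;>
    by_cases hj : j = j' <;> simp [hj]
  rw [hdet, ← fromBlocks_toBlocks J, h12, det_fromBlocks_zero₁₂, h11, h22, det_kronecker]
  simp only [det_smul, det_one, Fintype.card_fin, one_pow, mul_one, det_fin_two_of]
  congr 1
  · field_simp; ring
  · congr 1; field_simp; ring

end Jacobian

/-! ### Uniform lower bound for the rescaled map -/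

section Bounds

variable {n : ℕ}

set_option maxHeartbeats 600000 in
/-- The rescaled map is bounded below by the distance to its zero, uniformly in the parameters. -/
lemma exists_le_norm_scaledMap {k : ℕ} (hk : k + 1 < n - 2) {a A : ℝ} (ha : 0 < a) (hA : 1 ≤ A) :
    ∃ κ₀ B : ℝ, 0 < κ₀ ∧ 0 < B ∧ ∀ (κ α : ℝ) (η : EuclideanSpace ℝ (Fin n)) (x₁ x₂ : ℝ)
      (y₁ y₂ : EuclideanSpace ℝ (Fin n)), 0 ≤ κ → κ ≤ κ₀ → 0 < α → α ≤ A → ‖η‖ ≤ 1 →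
      1 / 2 ≤ x₁ → x₁ ≤ 2 → 1 / 2 ≤ x₂ → x₂ ≤ 2 →
      |x₁ - 1| + |x₂ - 1| + ‖y₁‖ + ‖y₂‖ ≤ B * ‖scaledMap k a κ α η x₁ x₂ y₁ y₂‖ := by
  set r : ℝ := (1 / 2) ^ k with hr
  set M : ℝ := 2 ^ (n + 1) with hM
  set L : ℝ := (n * 2 ^ n + (k + 1) * 2 ^ k : ℝ) with hL
  have hr0 : 0 < r := by positivity
  have hM0 : 0 < M := by positivity
  have hL0 : 0 ≤ L := by positivity
  -- The bound on `κ` lets the coupling terms be absorbed into half of `r * a * (‖y₁‖ + ‖y₂‖)`. In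
  -- `B`, the first summand pays for `|x₁ - 1| + |x₂ - 1|`, the second for `‖y₁‖ + ‖y₂‖`.
  refine ⟨r * a / (4 * A ^ 2 * M), 2 ^ (k + 4) + 4 * A ^ 2 * (1 + 2 * a * L * 2 ^ (k + 4)) / (r * a),
    by positivity, by positivity, ?_⟩
  intro κ α η x₁ x₂ y₁ y₂ hκ hκ₀ hα hαA hη hx₁ hx₁' hx₂ hx₂'
  have hx₁0 : 0 < x₁ := by linarith
  have hx₂0 : 0 < x₂ := by linarith
  set G₁ : EuclideanSpace ℝ (Fin n) := -(a * x₁ ^ k) • y₁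
      + (κ * (√(x₁ * x₂) ^ n / x₂)) • (y₁ - y₂) + (a * (√(x₁ * x₂) ^ n / x₂ - x₁ ^ k)) • η with hG₁
  set G₂ : EuclideanSpace ℝ (Fin n) := -(a / α * x₂ ^ k) • y₂
      + (α * κ * (√(x₁ * x₂) ^ n / x₁)) • (y₂ - y₁)
      + (a / α * (√(x₁ * x₂) ^ n / x₁ - x₂ ^ k)) • (-(α ^ 2) • η) with hG₂
  set F : ℝ := ‖scaledMap k a κ α η x₁ x₂ y₁ y₂‖ with hF
  have hF0 : 0 ≤ F := norm_nonneg _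
  have hf₁ : |x₁ ^ (k + 1) - √(x₁ * x₂) ^ (n - 2)| ≤ F := Param.abs_fst_le _ _ G₁ G₂
  have hf₂ : |x₂ ^ (k + 1) - √(x₁ * x₂) ^ (n - 2)| ≤ F := Param.abs_snd_le _ _ G₁ G₂
  have hg₁ : ‖G₁‖ ≤ F := Param.norm_xi₁_le _ _ G₁ G₂
  have hg₂ : ‖G₂‖ ≤ F := Param.norm_xi₂_le _ _ G₁ G₂
  clear_value G₁ G₂ F
  have hu₁ : |x₁ - 1| ≤ 2 ^ (k + 3) * F := by
    have := abs_sub_one_le_of_pow_diff (r := 1 / 2) (by norm_num) (by norm_num) hx₁ hx₂ hk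
    refine this.trans ?_
    rw [show ((1 / 2 : ℝ))⁻¹ = 2 by norm_num, show (2 : ℝ) ^ (k + 3) * F
      = 2 * 2 ^ (k + 1) * (F + F) by ring]
    gcongr
  have hu₂ : |x₂ - 1| ≤ 2 ^ (k + 3) * F := by
    have := abs_sub_one_le_of_pow_diff (r := 1 / 2) (by norm_num) (by norm_num) hx₂ hx₁ hk
    rw [mul_comm x₂] at this
    refine this.trans ?_
    rw [show ((1 / 2 : ℝ))⁻¹ = 2 by norm_num, show (2 : ℝ) ^ (k + 3) * F
      = 2 * 2 ^ (k + 1) * (F + F) by ring]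
    gcongr
  set U := |x₁ - 1| + |x₂ - 1| with hU
  have hU0 : 0 ≤ U := by positivity
  have hUF : U ≤ 2 ^ (k + 4) * F := by
    rw [show (2 : ℝ) ^ (k + 4) * F = 2 ^ (k + 3) * F + 2 ^ (k + 3) * F by ring]
    exact add_le_add hu₁ hu₂
  have hs2 : √(x₁ * x₂) ≤ 2 := (sqrt_mul_le_max hx₁0.le hx₂0.le).trans (max_le hx₁' hx₂')
  have hbound {x : ℝ} (hx : 1 / 2 ≤ x) : √(x₁ * x₂) ^ n / x ≤ M := by
    rw [div_le_iff₀ (by linarith)]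
    have := pow_le_pow_left₀ (Real.sqrt_nonneg _) hs2 n
    have : (2 : ℝ) ^ n ≤ M * x := by rw [hM, pow_succ]; nlinarith [pow_pos (zero_lt_two' ℝ) n]
    linarith
  have hdiff {x z : ℝ} (hx : 1 / 2 ≤ x) (hz : |√(x₁ * x₂) ^ n - x * z| ≤ L * U) :
      |√(x₁ * x₂) ^ n / x - z| ≤ 2 * L * U := by
    have hx0 : 0 < x := by linarith
    have e : √(x₁ * x₂) ^ n / x - z = (√(x₁ * x₂) ^ n - x * z) / x := by field_simp
    rw [e, abs_div, abs_of_pos hx0, div_le_iff₀ hx0]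
    nlinarith [mul_nonneg hL0 hU0]
  have hd₁ : |√(x₁ * x₂) ^ n / x₂ - x₁ ^ k| ≤ 2 * L * U :=
    hdiff hx₂ (abs_sqrt_pow_sub_mul_le hx₁0.le hx₂0.le hx₁' hx₂' n k)
  have hd₂ : |√(x₁ * x₂) ^ n / x₁ - x₂ ^ k| ≤ 2 * L * U := by
    refine hdiff hx₁ ?_
    have := abs_sqrt_pow_sub_mul_le hx₂0.le hx₁0.le hx₂' hx₁' n k
    rwa [mul_comm x₂, add_comm |x₂ - 1|] at this
  have h₁ := norm_le_of_perturbed ha hκ hr0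
    (pow_le_pow_left₀ (by norm_num : (0 : ℝ) ≤ 1 / 2) hx₁ k) (by positivity) (hbound hx₂) hd₁ hG₁
  have h₂ := norm_le_of_perturbed (div_pos ha hα) (mul_nonneg hα.le hκ) hr0
    (pow_le_pow_left₀ (by norm_num : (0 : ℝ) ≤ 1 / 2) hx₂ k) (by positivity) (hbound hx₁) hd₂ hG₂
  set Y := ‖y₁‖ + ‖y₂‖ with hY
  have hY0 : 0 ≤ Y := by positivity
  have hA2 : 1 ≤ A ^ 2 := one_le_pow₀ hA
  have hαA2 : α ^ 2 ≤ A ^ 2 := pow_le_pow_left₀ hα.le hαA 2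
  set W := F + κ * M * Y + 2 * a * L * U with hW
  have hW0 : 0 ≤ W := by positivity
  have h₁' : r * a * ‖y₁‖ ≤ A ^ 2 * W := by
    have e1 : a * (2 * L * U) * ‖η‖ ≤ 2 * a * L * U := by
      have : 0 ≤ a * (2 * L * U) := by positivity
      nlinarith
    calc r * a * ‖y₁‖ ≤ W := by rw [hW]; linarith
      _ ≤ A ^ 2 * W := le_mul_of_one_le_left hW0 hA2
  -- Multiplying by `α` clears the coefficient `a / α`; the factors `α` and `α ^ 2` that result are
  -- at most `A ^ 2`.
  have h₂' : r * a * ‖y₂‖ ≤ A ^ 2 * W := by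
    rw [norm_smul, norm_neg, Real.norm_of_nonneg (sq_nonneg α), add_comm ‖y₂‖, ← hY] at h₂
    have e0 := mul_le_mul_of_nonneg_left h₂ hα.le
    have e3 : α * (a / α) = a := mul_div_cancel₀ a hα.ne'
    have e1 : α * (r * (a / α) * ‖y₂‖) = r * a * ‖y₂‖ := by linear_combination r * ‖y₂‖ * e3
    have e2 : α * (‖G₂‖ + α * κ * M * Y + a / α * (2 * L * U) * (α ^ 2 * ‖η‖))
        = α * ‖G₂‖ + α ^ 2 * (κ * M * Y) + α ^ 2 * (2 * a * L * U * ‖η‖) := by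
      linear_combination ((2 * L * U) * (α ^ 2 * ‖η‖)) * e3
    rw [e1, e2] at e0
    have f1 : α * ‖G₂‖ ≤ A ^ 2 * F :=
      mul_le_mul (hαA.trans (le_self_pow₀ hA two_ne_zero)) hg₂ (norm_nonneg _) (by positivity)
    have f2 : α ^ 2 * (κ * M * Y) ≤ A ^ 2 * (κ * M * Y) :=
      mul_le_mul_of_nonneg_right hαA2 (by positivity)
    have f3 : α ^ 2 * (2 * a * L * U * ‖η‖) ≤ A ^ 2 * (2 * a * L * U) :=
      mul_le_mul hαA2 (mul_le_of_le_one_right (by positivity) hη) (by positivity) (by positivity)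
    calc _ ≤ _ := e0
      _ ≤ A ^ 2 * F + A ^ 2 * (κ * M * Y) + A ^ 2 * (2 * a * L * U) := by linarith
      _ = A ^ 2 * W := by rw [hW]; ring
  have h₃ : 4 * A ^ 2 * (κ * M * Y) ≤ r * a * Y := by
    rw [le_div_iff₀ (by positivity)] at hκ₀
    nlinarith
  have h₄ : r * a * Y ≤ 4 * A ^ 2 * (1 + 2 * a * L * 2 ^ (k + 4)) * F := by
    have e1 : r * a * Y ≤ 4 * A ^ 2 * (F + 2 * a * L * U) := by
      have : r * a * Y = r * a * ‖y₁‖ + r * a * ‖y₂‖ := by rw [hY]; ring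
      have : A ^ 2 * W = A ^ 2 * (κ * M * Y) + A ^ 2 * (F + 2 * a * L * U) := by rw [hW]; ring
      linarith
    refine e1.trans ?_
    rw [mul_assoc (4 * A ^ 2)]
    refine mul_le_mul_of_nonneg_left ?_ (by positivity)
    have := mul_le_mul_of_nonneg_left hUF (by positivity : 0 ≤ 2 * a * L)
    linarith
  have h₅ : Y ≤ 4 * A ^ 2 * (1 + 2 * a * L * 2 ^ (k + 4)) / (r * a) * F := by
    rw [div_mul_eq_mul_div, le_div_iff₀ (by positivity)]
    linarith
  rw [add_mul]
  linarith

/-- Every point in the coordinates of a scaling. -/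
lemma exists_scaled_coordinates {l α : ℝ} (hl : 0 < l) (hα : 0 < α)
    (q η : EuclideanSpace ℝ (Fin n)) (P : Param n) :
    ∃ (x₁ x₂ : ℝ) (y₁ y₂ : EuclideanSpace ℝ (Fin n)),
      P = Param.mk (l * x₁) (α * l * x₂) (l • η + l • y₁) (q - (α ^ 2) • (l • η) + l • y₂) ∧
      P - centre q l α η =
        Param.mk (l * (x₁ - 1)) (α * l * (x₂ - 1)) (l • y₁) (l • y₂) := by
  have key : P = Param.mk (l * (P.lam₁ / l)) (α * l * (P.lam₂ / (α * l)))
      (l • η + l • (l⁻¹ • (P.xi₁ - l • η)))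
      (q - (α ^ 2) • (l • η) + l • (l⁻¹ • (P.xi₂ - (q - (α ^ 2) • (l • η))))) := by
    rw [smul_inv_smul₀ hl.ne', smul_inv_smul₀ hl.ne', mul_div_cancel₀ _ hl.ne',
      mul_div_cancel₀ _ (mul_pos hα hl).ne', add_sub_cancel, add_sub_cancel, Param.mk_eta]
  refine ⟨_, _, _, _, key, ?_⟩
  nth_rewrite 1 [key]
  rw [centre, Param.mk_sub_mk, add_sub_cancel_left, add_sub_cancel_left]
  congr 1 <;> ring

end Bounds

/-! ### The data of `P_τ` and their size for large `D_τ` -/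

section Existence

variable {n : ℕ}

lemma alpha_pos {ℓ : ℕ} {w₁ w₂ : ℝ} (hw₁ : w₁ < 0) (hw₂ : w₂ < 0) : 0 < alpha ℓ w₁ w₂ :=
  Real.rpow_pos_of_pos (div_pos_of_neg_of_neg hw₁ hw₂) _

lemma alpha_pow {ℓ : ℕ} (hℓ : ℓ ≠ 0) {w₁ w₂ : ℝ} (hw₁ : w₁ < 0) (hw₂ : w₂ < 0) :
    alpha ℓ w₁ w₂ ^ ℓ = w₁ / w₂ := by
  rw [alpha, one_div, Real.rpow_inv_natCast_pow (div_pos_of_neg_of_neg hw₁ hw₂).le hℓ]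

lemma alpha_bounds {ℓ : ℕ} {w₁ w₂ Cp : ℝ} (hCp : 0 < Cp) (hw₁ : w₁ < 0)
    (hw₂ : w₂ < 0) (h₁ : 1 / Cp * |w₁| ≤ |w₂|) (h₂ : |w₂| ≤ Cp * |w₁|) :
    alpha ℓ w₁ w₂ ≤ Cp ^ (1 / (ℓ : ℝ)) ∧ 1 ≤ Cp ^ (1 / (ℓ : ℝ)) * alpha ℓ w₁ w₂ := by
  rw [abs_of_neg hw₁, abs_of_neg hw₂] at h₁ h₂
  have hq : 0 < w₁ / w₂ := div_pos_of_neg_of_neg hw₁ hw₂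
  have hq1 : w₁ / w₂ ≤ Cp := by
    rw [div_le_iff_of_neg hw₂]
    rw [one_div_mul_eq_div, div_le_iff₀ hCp] at h₁
    linarith
  have hq2 : 1 ≤ Cp * (w₁ / w₂) := by
    rw [← mul_div_assoc, one_le_div_of_neg hw₂]
    linarith
  refine ⟨Real.rpow_le_rpow hq.le hq1 (by positivity), ?_⟩
  rw [alpha, ← Real.mul_rpow hCp.le hq.le]
  exact Real.one_le_rpow hq2 (by positivity)

lemma lamTau₁_pos {ℓ : ℕ} {C₁ w₁ w₂ : ℝ} {q : EuclideanSpace ℝ (Fin n)} (hC₁ : 0 < C₁)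
    (hw₁ : w₁ < 0) (hw₂ : w₂ < 0) (hq : q ≠ 0) : 0 < lamTau₁ ℓ C₁ w₁ w₂ q := by
  have := alpha_pos (ℓ := ℓ) hw₁ hw₂
  have := norm_pos_iff.2 hq
  have := abs_pos.2 hw₁.ne
  rw [lamTau₁]
  positivity

lemma lamTau_eq {ℓ : ℕ} {C₁ w₁ w₂ : ℝ} {q : EuclideanSpace ℝ (Fin n)} (hC₁ : 0 < C₁)
    (hw₁ : w₁ < 0) (hw₂ : w₂ < 0) (hq : q ≠ 0) :
    lamTau ℓ C₁ w₁ w₂ q = √(alpha ℓ w₁ w₂) * lamTau₁ ℓ C₁ w₁ w₂ q := by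
  rw [lamTau, lamTau₂, mul_left_comm, Real.sqrt_mul (alpha_pos hw₁ hw₂).le,
    Real.sqrt_mul_self (lamTau₁_pos hC₁ hw₁ hw₂ hq).le]

/-- This is `T_{1_o} = 0` at `P_τ`; the formula for `λ_{1τ}` is the solution of this equation. -/
lemma sqrt_alpha_mul_lamTau₁_div_pow {ℓ : ℕ} (hℓn : ℓ + 2 < n) {C₁ w₁ w₂ : ℝ}
    {q : EuclideanSpace ℝ (Fin n)} (hC₁ : 0 < C₁) (hw₁ : w₁ < 0) (hw₂ : w₂ < 0) (hq : q ≠ 0) :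
    (√(alpha ℓ w₁ w₂) * lamTau₁ ℓ C₁ w₁ w₂ q / ‖q‖) ^ (n - 2) =
      C₁ * |w₁| * lamTau₁ ℓ C₁ w₁ w₂ q ^ ℓ := by
  have hα := alpha_pos (ℓ := ℓ) hw₁ hw₂
  have hq0 := norm_pos_iff.2 hq
  have hw := abs_pos.2 hw₁.ne
  -- Now `(n - 2) - ℓ` is the nonzero natural number `d + 1`, so the real root in `lamTau₁` is
  -- undone by an ordinary power.
  obtain ⟨d, rfl⟩ : ∃ d, n = ℓ + (d + 1) + 2 := ⟨n - 2 - ℓ - 1, by omega⟩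
  have hpow : lamTau₁ ℓ C₁ w₁ w₂ q ^ (d + 1) =
      ‖q‖ ^ (ℓ + (d + 1)) * (C₁ * |w₁| / √(alpha ℓ w₁ w₂) ^ (ℓ + (d + 1))) := by
    rw [lamTau₁]
    have e1 : (((ℓ + (d + 1) + 2 : ℕ) : ℝ) - 2) - (ℓ : ℝ) = ((d + 1 : ℕ) : ℝ) := by
      push_cast; ring
    have e2 : alpha ℓ w₁ w₂ ^ ((((ℓ + (d + 1) + 2 : ℕ) : ℝ) - 2) / 2)
        = √(alpha ℓ w₁ w₂) ^ (ℓ + (d + 1)) := by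
      rw [Real.sqrt_eq_rpow, ← Real.rpow_natCast, ← Real.rpow_mul hα.le]
      congr 1
      push_cast; ring
    rw [e1, e2, one_div, Real.rpow_inv_natCast_pow (by positivity) (Nat.succ_ne_zero d),
      Nat.add_sub_cancel]
  rw [Nat.add_sub_cancel, div_pow, mul_pow, pow_add (lamTau₁ ℓ C₁ w₁ w₂ q), hpow]
  have := Real.sqrt_pos.2 hα
  field_simp

lemma xiTau₁_eq (ℓ : ℕ) (C₁ C₂ C₃ w₁ w₂ : ℝ) (q : EuclideanSpace ℝ (Fin n)) :
    xiTau₁ ℓ C₁ C₂ C₃ w₁ w₂ q =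
      (-(C₃ * (1 / DTau ℓ C₁ w₁ w₂ q ^ 2) * (1 / alpha ℓ w₁ w₂)) /
        (C₂ / C₁ - C₃ * (1 / DTau ℓ C₁ w₁ w₂ q ^ 2) * (1 / alpha ℓ w₁ w₂) *
          (1 + alpha ℓ w₁ w₂ ^ 2))) • q := by
  rw [xiTau₁, beta, one_div (_)⁻¹, inv_inv]

/-- The data of `P_τ` form a scaling; `κ` and `η` are small when `D_τ` is large. -/
lemma exists_scaling {k : ℕ} (hkn : k + 1 + 2 < n) {C₁ C₂ C₃ : ℝ} (hC₁ : 0 < C₁) (hC₂ : 0 < C₂)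
    (hC₃ : 0 < C₃) {A κ₀ η₀ : ℝ} (hA : 1 ≤ A) (hκ₀ : 0 < κ₀) (hη₀ : 0 < η₀) :
    ∃ Dbar : ℝ, 0 < Dbar ∧ ∀ (w₁ w₂ : ℝ) (q : EuclideanSpace ℝ (Fin n)), w₁ < 0 → w₂ < 0 → q ≠ 0 →
      alpha (k + 1) w₁ w₂ ≤ A → 1 ≤ A * alpha (k + 1) w₁ w₂ →
      Dbar ≤ DTau (k + 1) C₁ w₁ w₂ q →
      ∃ (κ : ℝ) (η : EuclideanSpace ℝ (Fin n)),
        Scaling k C₁ C₂ C₃ w₁ w₂ q (lamTau₁ (k + 1) C₁ w₁ w₂ q) (alpha (k + 1) w₁ w₂)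
          (C₁ * |w₁| * lamTau₁ (k + 1) C₁ w₁ w₂ q ^ (k + 1)) (C₂ / C₁) κ η ∧
        PTau (k + 1) C₁ C₂ C₃ w₁ w₂ q =
          centre q (lamTau₁ (k + 1) C₁ w₁ w₂ q) (alpha (k + 1) w₁ w₂) η ∧
        0 ≤ κ ∧ κ ≤ κ₀ ∧ ‖η‖ ≤ η₀ ∧ κ * (1 + alpha (k + 1) w₁ w₂ ^ 2) < C₂ / C₁ := by
  set a := C₂ / C₁ with ha_def
  have ha : 0 < a := div_pos hC₂ hC₁
  have hA0 : 0 < A := by linarith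
  -- The second bound keeps the coefficient `a - κ (1 + α²)` of `ξ_{1τ}` at least `a / 2`, so that
  -- `ξ_{1τ}` is well defined.
  set κ₁ := min κ₀ (a / (2 * (1 + A ^ 2))) with hκ₁
  have hκ₁0 : 0 < κ₁ := lt_min hκ₀ (by positivity)
  -- The summands ensure, in turn, `D ≥ 1`, then `κ ≤ C₃ A / D² ≤ κ₁`, and `‖η‖ ≤ 2 C₃ A² / (a D) ≤
  -- η₀`.
  refine ⟨1 + C₃ * A / κ₁ + 2 * C₃ * A ^ 2 / (a * η₀), by positivity, ?_⟩
  intro w₁ w₂ q hw₁ hw₂ hq hαA hαA' hD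
  have hα := alpha_pos (ℓ := k + 1) hw₁ hw₂
  have hl := lamTau₁_pos (ℓ := k + 1) hC₁ hw₁ hw₂ hq
  have hq0 := norm_pos_iff.2 hq
  have hw := abs_pos.2 hw₁.ne
  have hlam := lamTau_eq (ℓ := k + 1) hC₁ hw₁ hw₂ hq
  have hpw := sqrt_alpha_mul_lamTau₁_div_pow hkn hC₁ hw₁ hw₂ hq
  have hαp := alpha_pow (Nat.succ_ne_zero k) hw₁ hw₂
  have hDdef : DTau (k + 1) C₁ w₁ w₂ q = ‖q‖ / lamTau (k + 1) C₁ w₁ w₂ q := rfl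
  have hxi := xiTau₁_eq (k + 1) C₁ C₂ C₃ w₁ w₂ q
  rw [← ha_def] at hxi
  rw [hlam] at hDdef
  have hP : PTau (k + 1) C₁ C₂ C₃ w₁ w₂ q = Param.mk (lamTau₁ (k + 1) C₁ w₁ w₂ q)
      (alpha (k + 1) w₁ w₂ * lamTau₁ (k + 1) C₁ w₁ w₂ q) (xiTau₁ (k + 1) C₁ C₂ C₃ w₁ w₂ q)
      (q - (alpha (k + 1) w₁ w₂ ^ 2) • xiTau₁ (k + 1) C₁ C₂ C₃ w₁ w₂ q) := by
    rw [PTau, xiTau₂, beta, one_div, inv_inv, lamTau₂]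
  rw [hP]
  generalize xiTau₁ (k + 1) C₁ C₂ C₃ w₁ w₂ q = ξ at *
  generalize DTau (k + 1) C₁ w₁ w₂ q = D at *
  generalize alpha (k + 1) w₁ w₂ = α at *
  generalize lamTau₁ (k + 1) C₁ w₁ w₂ q = l at *
  have hsα : 0 < √α := Real.sqrt_pos.2 hα
  have t1 : 0 < C₃ * A / κ₁ := by positivity
  have t2 : 0 < 2 * C₃ * A ^ 2 / (a * η₀) := by positivity
  have hD1 : 1 ≤ D := by linarith
  have hDκ : C₃ * A / κ₁ ≤ D := by linarith
  have hDη : 2 * C₃ * A ^ 2 / (a * η₀) ≤ D := by linarith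
  have hD0 : 0 < D := by linarith
  set κ := C₃ * (1 / D ^ 2) * (1 / α) with hκ
  have hκ0 : 0 < κ := by positivity
  have hα1 : 1 / α ≤ A := by rw [div_le_iff₀ hα]; exact hαA'
  have hκD : κ ≤ C₃ * A / D ^ 2 := by
    have := mul_le_mul_of_nonneg_left hα1 (by positivity : 0 ≤ C₃ * (1 / D ^ 2))
    calc κ ≤ _ := this
      _ = _ := by ring
  have hκκ₁ : κ ≤ κ₁ := by
    refine hκD.trans ?_
    rw [div_le_iff₀ hκ₁0] at hDκ
    rw [div_le_iff₀ (by positivity)]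
    nlinarith [mul_le_mul_of_nonneg_right hD1 (mul_pos hD0 hκ₁0).le]
  have hα2 : α ^ 2 ≤ A ^ 2 := pow_le_pow_left₀ hα.le hαA 2
  have hhalf : κ * (1 + α ^ 2) ≤ a / 2 := by
    have h1 : κ ≤ a / (2 * (1 + A ^ 2)) := hκκ₁.trans (min_le_right _ _)
    rw [le_div_iff₀ (by positivity)] at h1
    nlinarith
  have hden : 0 < a - κ * (1 + α ^ 2) := by linarith
  refine ⟨κ, l⁻¹ • ξ, ?_, ?_, hκ0.le, hκκ₁.trans (min_le_left _ _), ?_, by linarith⟩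
  · have hsq : D ^ 2 * (√α * l / ‖q‖) ^ 2 = 1 := by
      rw [hDdef]; field_simp
    have hw₂' : |w₂| = |w₁| / α ^ (k + 1) := by
      rw [hαp, abs_of_neg hw₁, abs_of_neg hw₂]
      have := hw₁.ne
      have := hw₂.ne
      field_simp
    have hC : a * C₁ = C₂ := div_mul_cancel₀ _ hC₁.ne'
    have hW₂ : C₁ * |w₂| * (α * l) ^ (k + 1) = C₁ * |w₁| * l ^ (k + 1) := by
      rw [hw₂', mul_pow]; field_simp
    refine ⟨by omega, hl, hα, by positivity, hq, ?_, ?_, rfl, hW₂, hpw, ?_, ?_⟩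
    · rw [abs_of_neg hw₁, ← hC]; ring
    · rw [← hW₂, abs_of_neg hw₂, ← hC]; ring
    · rw [hκ]
      have e : (√α * l / ‖q‖) ^ 2 = 1 / D ^ 2 := by
        rw [eq_div_iff (by positivity), mul_comm]; exact hsq
      rw [e]; field_simp
    · rw [hxi]
      simp only [smul_smul, ← add_smul]
      congr 1
      field_simp
      ring
  · rw [centre, smul_inv_smul₀ hl.ne']
  · have hql : ‖q‖ = D * √α * l := by rw [hDdef]; field_simp
    have hsA : √α ≤ A := by
      refine (Real.sqrt_le_sqrt hαA).trans ?_
      rw [Real.sqrt_le_left hA0.le]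
      nlinarith
    have e : ‖l⁻¹ • ξ‖ = κ / (a - κ * (1 + α ^ 2)) * (D * √α) := by
      rw [hxi, norm_smul, norm_smul, hql, norm_div, norm_neg, norm_inv, Real.norm_of_nonneg hl.le,
        Real.norm_of_nonneg hκ0.le, Real.norm_of_nonneg hden.le]
      field_simp
    rw [e]
    have h1 : κ / (a - κ * (1 + α ^ 2)) ≤ (C₃ * A / D ^ 2) / (a / 2) :=
      div_le_div₀ (by positivity) hκD (by positivity) (by linarith)
    calc _ ≤ (C₃ * A / D ^ 2) / (a / 2) * (D * A) :=
          mul_le_mul h1 (mul_le_mul_of_nonneg_left hsA hD0.le) (by positivity) (by positivity)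
      _ = 2 * C₃ * A ^ 2 / (a * η₀) * η₀ / D := by field_simp
      _ ≤ D * η₀ / D := by gcongr
      _ = η₀ := by field_simp

end Existence

/-! ### Uniqueness of the zero and the degree -/

section Degree

variable {n k : ℕ} {C₁ C₂ C₃ w₁ w₂ : ℝ} {q : EuclideanSpace ℝ (Fin n)} {l α E a κ : ℝ}
  {η : EuclideanSpace ℝ (Fin n)}

lemma Scaling.modelMap_centre (h : Scaling k C₁ C₂ C₃ w₁ w₂ q l α E a κ η) :
    modelMap (k + 1) C₁ C₂ C₃ w₁ w₂ q (centre q l α η) = 0 := by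
  have h1 := h.modelMap_eq one_pos one_pos 0 0
  have h2 : scaledMap k a κ α η 1 1 0 0 = 0 := by
    rw [scaledMap, Param.mk_eq_zero_iff]
    simp
  rw [h2, smul_zero] at h1
  simpa [centre] using h1

/-- The zero may lie anywhere in the domain. The constant in the scalar estimate then depends on the
point, but it multiplies zero, so `x₁ = x₂ = 1`; the lower bound is needed only there. -/
lemma Scaling.eq_centre (h : Scaling k C₁ C₂ C₃ w₁ w₂ q l α E a κ η) (hk : k + 1 < n - 2) {B : ℝ}
    (hB : ∀ y₁ y₂, ‖y₁‖ + ‖y₂‖ ≤ B * ‖scaledMap k a κ α η 1 1 y₁ y₂‖)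
    {P : Param n} (hP : P ∈ domain n) (hP0 : modelMap (k + 1) C₁ C₂ C₃ w₁ w₂ q P = 0) :
    P = centre q l α η := by
  have hl := h.l_pos
  have hα := h.α_pos
  obtain ⟨x₁, x₂, y₁, y₂, rfl, hsub⟩ := exists_scaled_coordinates hl hα q η P
  have hx₁ : 0 < x₁ := pos_of_mul_pos_right hP.1 hl.le
  have hx₂ : 0 < x₂ := pos_of_mul_pos_right hP.2 (mul_pos hα hl).le
  rw [h.modelMap_eq hx₁ hx₂, smul_eq_zero_iff_right h.E_pos.ne'] at hP0
  obtain ⟨e₁, e₂, -, -⟩ := Param.mk_eq_zero_iff.1 hP0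
  have hr : 0 < min 1 (min x₁ x₂) := lt_min one_pos (lt_min hx₁ hx₂)
  have h₁ := abs_sub_one_le_of_pow_diff hr (min_le_left _ _)
    ((min_le_right _ _).trans (min_le_left _ _)) ((min_le_right _ _).trans (min_le_right x₁ x₂)) hk
  have h₂ := abs_sub_one_le_of_pow_diff hr (min_le_left _ _)
    ((min_le_right _ _).trans (min_le_right x₁ x₂)) ((min_le_right _ _).trans (min_le_left _ _)) hk
  rw [mul_comm x₂] at h₂
  rw [e₁, e₂, abs_zero, add_zero, mul_zero, abs_nonpos_iff, sub_eq_zero] at h₁ h₂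
  subst h₁ h₂
  have h₃ := hB y₁ y₂
  rw [hP0, norm_zero, mul_zero] at h₃
  have hy₁ : y₁ = 0 := norm_le_zero_iff.1 (by linarith [norm_nonneg y₂])
  have hy₂ : y₂ = 0 := norm_le_zero_iff.1 (by linarith [norm_nonneg y₁])
  rw [← sub_eq_zero, hsub, hy₁, hy₂, Param.mk_eq_zero_iff]
  simp

/-- The sign comes from `ℓ - (n - 2) < 0`; the `n`-th power has a positive base, so the parity of
`n` is irrelevant. -/
lemma Scaling.det_fderiv_neg (h : Scaling k C₁ C₂ C₃ w₁ w₂ q l α E a κ η) (hk : k + 1 < n - 2)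
    (ha : 0 < a) (hκ : κ * (1 + α ^ 2) < a) :
    (fderiv ℝ (modelMap (k + 1) C₁ C₂ C₃ w₁ w₂ q) (centre q l α η)).det < 0 := by
  have hl := h.l_pos
  have hα := h.α_pos
  have hE := h.E_pos
  have hk' : ((k : ℝ) + 1) - ((n : ℝ) - 2) < 0 := by
    have : ((k + 1 + 2 : ℕ) : ℝ) < n := by exact_mod_cast (by omega : k + 1 + 2 < n)
    push_cast at this
    linarith
  rw [h.det_fderiv]
  refine mul_neg_of_neg_of_pos ?_ ?_
  · exact mul_neg_of_pos_of_neg (by positivity) (mul_neg_of_pos_of_neg (by positivity) hk')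
  · have : 0 < a - κ * (1 + α ^ 2) := by linarith
    positivity

/-- A map which is `C¹` on an open set containing a closed ball, and which vanishes in that open set
only at the centre of the ball, with a negative Jacobian determinant there. -/
lemma brouwerDegree_ball_eq_neg_one {V : Type*} [NormedAddCommGroup V] [NormedSpace ℝ V]
    {f : V → V} {s : Set V} {z : V} {r : ℝ} (hr : 0 < r) (hs : Metric.closedBall z r ⊆ s)
    (hf : ContDiffOn ℝ 1 f s) (hz : f z = 0) (huniq : ∀ x ∈ s, f x = 0 → x = z)
    (hdet : (fderiv ℝ f z).det < 0) : brouwerDegree f (Metric.ball z r) 0 = -1 := by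
  have hb : Metric.ball z r ⊆ s := Metric.ball_subset_closedBall.trans hs
  have hadm : DegreeAdmissible f (Metric.ball z r) 0 := by
    refine ⟨Metric.isOpen_ball, Metric.isBounded_ball,
      hf.continuousOn.mono (Metric.closure_ball_subset_closedBall.trans hs), fun x hx h0 => ?_⟩
    have hx' := Metric.frontier_ball_subset_sphere hx
    rw [huniq x (hs (Metric.sphere_subset_closedBall hx')) h0, Metric.mem_sphere, dist_self] at hx'
    exact hr.ne hx'
  -- Zero is a regular value, so the degree is a signed count with one term and no approximation
  -- enters.
  have hreg : RegularIn f (Metric.ball z r) 0 :=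
    ⟨hf.mono hb, fun x hx h0 => huniq x (hb hx) h0 ▸ hdet.ne⟩
  have hset : {x : V | x ∈ Metric.ball z r ∧ f x = 0} = {z} := by
    ext x
    constructor
    · rintro ⟨hx, h0⟩
      exact huniq x (hb hx) h0
    · rintro rfl
      exact ⟨Metric.mem_ball_self hr, hz⟩
  rw [brouwerDegree, if_pos hadm, if_pos hreg, signedCount, hset, finsum_mem_singleton,
    sign_neg hdet]
  rfl

end Degree

/-! ### Scale and flatness conditions near `P_τ` -/

section Ball

variable {n k : ℕ} {C₁ C₂ C₃ w₁ w₂ : ℝ} {q : EuclideanSpace ℝ (Fin n)} {l α E a κ : ℝ}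
  {η : EuclideanSpace ℝ (Fin n)}

/-- The rescaled coordinates of a point close to `P_τ`. -/
lemma exists_scaled_coordinates_of_norm_sub_le {A δ μ : ℝ} (hl : 0 < l) (hα : 0 < α) (hA : 1 ≤ A)
    (hαA : 1 ≤ A * α) (hμδ : A * μ ≤ δ) {P : Param n}
    (hP : ‖P - centre q l α η‖ ≤ μ * l) :
    ∃ (x₁ x₂ : ℝ) (y₁ y₂ : EuclideanSpace ℝ (Fin n)),
      P = Param.mk (l * x₁) (α * l * x₂) (l • η + l • y₁) (q - (α ^ 2) • (l • η) + l • y₂) ∧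
      P - centre q l α η =
        Param.mk (l * (x₁ - 1)) (α * l * (x₂ - 1)) (l • y₁) (l • y₂) ∧
      |x₁ - 1| ≤ δ ∧ |x₂ - 1| ≤ δ ∧ ‖y₁‖ ≤ δ ∧ ‖y₂‖ ≤ δ := by
  obtain ⟨x₁, x₂, y₁, y₂, h, hsub⟩ := exists_scaled_coordinates hl hα q η P
  have hμ0 : 0 ≤ μ := nonneg_of_mul_nonneg_left ((norm_nonneg _).trans hP) hl
  have hμ : μ ≤ δ := (le_mul_of_one_le_left hμ0 hA).trans hμδ
  refine ⟨x₁, x₂, y₁, y₂, h, hsub, ?_⟩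
  rw [hsub] at hP
  have h₁ := (Param.abs_fst_le _ _ _ _).trans hP
  have h₂ := (Param.abs_snd_le _ _ _ _).trans hP
  have h₃ := (Param.norm_xi₁_le _ _ _ _).trans hP
  have h₄ := (Param.norm_xi₂_le _ _ _ _).trans hP
  rw [abs_mul, abs_of_pos hl, mul_comm, mul_le_mul_iff_left₀ hl] at h₁
  rw [abs_mul, abs_of_pos (mul_pos hα hl), mul_right_comm, mul_le_mul_iff_left₀ hl] at h₂
  rw [norm_smul, Real.norm_of_nonneg hl.le, mul_comm, mul_le_mul_iff_left₀ hl] at h₃ h₄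
  refine ⟨h₁.trans hμ, ?_, h₃.trans hμ, h₄.trans hμ⟩
  have := abs_nonneg (x₂ - 1)
  -- `λ₂` has unit `α l` while the radius is measured in `l`; this costs a factor `1 / α ≤ A`.
  calc |x₂ - 1| ≤ A * α * |x₂ - 1| := le_mul_of_one_le_left this hαA
    _ = A * (α * |x₂ - 1|) := by ring
    _ ≤ A * μ := mul_le_mul_of_nonneg_left h₂ (by linarith)
    _ ≤ δ := hμδ

lemma lam_mk_scaled (hl : 0 < l) (hα : 0 < α) (x₁ x₂ : ℝ) (u v : EuclideanSpace ℝ (Fin n)) :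
    (Param.mk (l * x₁) (α * l * x₂) u v).lam = √α * l * √(x₁ * x₂) := by
  change √(l * x₁ * (α * l * x₂)) = _
  rw [show l * x₁ * (α * l * x₂) = α * (l ^ 2 * (x₁ * x₂)) by ring, Real.sqrt_mul hα.le,
    Real.sqrt_mul (sq_nonneg l), Real.sqrt_sq hl.le]
  ring

/-- Here `λ₁ / λ₂ = x₁ / (α x₂)` with `1 / A ≤ α ≤ A`, so a small `δ` suffices once `Cbar > A`. Both
`‖ξ₁‖` and `‖ξ₂ - q‖` are at most `2 δ l`, while `λ ≥ l / (2 A)`. -/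
lemma scaleCondition_mk_scaled {A δ Cbar cbar x₁ x₂ : ℝ} {y₁ y₂ : EuclideanSpace ℝ (Fin n)}
    (hl : 0 < l) (hα : 0 < α) (hA : 1 ≤ A) (hαA : α ≤ A) (hαA' : 1 ≤ A * α) (hδ : δ ≤ 1 / 2)
    (hδC : A * (1 + δ) < Cbar * (1 - δ)) (hδc : 4 * A * δ < cbar) (hη : A ^ 2 * ‖η‖ ≤ δ)
    (hx₁ : |x₁ - 1| ≤ δ) (hx₂ : |x₂ - 1| ≤ δ) (hy₁ : ‖y₁‖ ≤ δ) (hy₂ : ‖y₂‖ ≤ δ) :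
    ScaleCondition Cbar cbar q (Param.mk (l * x₁) (α * l * x₂) (l • η + l • y₁)
      (q - (α ^ 2) • (l • η) + l • y₂)) := by
  have hA0 : 0 < A := by linarith
  have hδ0 : 0 ≤ δ := (abs_nonneg _).trans hx₁
  rw [abs_le] at hx₁ hx₂
  have hC : 0 < Cbar := by
    have : 0 < A * (1 + δ) := by positivity
    exact pos_of_mul_pos_left (this.trans hδC) (by linarith)
  have hC₁ : A * x₂ < Cbar * x₁ :=
    calc A * x₂ ≤ A * (1 + δ) := mul_le_mul_of_nonneg_left (by linarith) hA0.le
      _ < Cbar * (1 - δ) := hδC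
      _ ≤ Cbar * x₁ := mul_le_mul_of_nonneg_left (by linarith) hC.le
  have hC₂ : A * x₁ < Cbar * x₂ :=
    calc A * x₁ ≤ A * (1 + δ) := mul_le_mul_of_nonneg_left (by linarith) hA0.le
      _ < Cbar * (1 - δ) := hδC
      _ ≤ Cbar * x₂ := mul_le_mul_of_nonneg_left (by linarith) hC.le
  have hx₁0 : 0 < x₁ := by linarith
  have hx₂0 : 0 < x₂ := by linarith
  have hsα : 1 ≤ A * √α := by
    refine le_of_sq_le_sq ?_ (by positivity)
    rw [mul_pow, Real.sq_sqrt hα.le]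
    nlinarith
  have hs : 1 / 2 ≤ √(x₁ * x₂) :=
    (le_min (by linarith) (by linarith)).trans (min_le_sqrt_mul hx₁0.le hx₂0.le)
  have hlam : l * (2 * δ) < cbar * (√α * l * √(x₁ * x₂)) := by
    have h1 : 1 ≤ 2 * A * (√α * √(x₁ * x₂)) := by nlinarith [mul_nonneg hA0.le (Real.sqrt_nonneg α)]
    have h2 : 2 * δ < cbar * (√α * √(x₁ * x₂)) := by
      have hp : 0 < √α * √(x₁ * x₂) := by positivity
      nlinarith [mul_lt_mul_of_pos_right hδc hp]
    calc l * (2 * δ) < l * (cbar * (√α * √(x₁ * x₂))) := mul_lt_mul_of_pos_left h2 hl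
      _ = _ := by ring
  have hη1 : ‖η‖ ≤ δ := le_trans (le_mul_of_one_le_left (norm_nonneg _) (one_le_pow₀ hA)) hη
  have hη2 : α ^ 2 * ‖η‖ ≤ δ :=
    le_trans (mul_le_mul_of_nonneg_right (pow_le_pow_left₀ hα.le hαA 2) (norm_nonneg _)) hη
  refine ⟨?_, ?_, ?_, ?_⟩
  · rw [Param.lam₁_mk, Param.lam₂_mk, inv_mul_lt_iff₀ hC]
    have : α * x₂ ≤ A * x₂ := mul_le_mul_of_nonneg_right hαA hx₂0.le
    nlinarith
  · rw [Param.lam₁_mk, Param.lam₂_mk]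
    have : x₁ ≤ α * (A * x₁) := by nlinarith
    have : α * (A * x₁) < α * (Cbar * x₂) := mul_lt_mul_of_pos_left hC₂ hα
    nlinarith
  · rw [Param.xi₁_mk, lam_mk_scaled hl hα, ← smul_add, norm_smul, Real.norm_of_nonneg hl.le]
    refine lt_of_le_of_lt (mul_le_mul_of_nonneg_left ?_ hl.le) hlam
    linarith [norm_add_le η y₁]
  · have e : q - (α ^ 2) • (l • η) + l • y₂ - q = l • (y₂ - (α ^ 2) • η) := by module
    rw [Param.xi₂_mk, lam_mk_scaled hl hα, e, norm_smul, Real.norm_of_nonneg hl.le]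
    refine lt_of_le_of_lt (mul_le_mul_of_nonneg_left ?_ hl.le) hlam
    have := norm_sub_le y₂ ((α ^ 2) • η)
    rw [norm_smul, Real.norm_of_nonneg (sq_nonneg α)] at this
    linarith

/-- As `D^{-(n-2)} = E s^{n-2}` and `E = C₁ |ϖ₁| l^ℓ`, the right-hand side equals `(A l)^ℓ (2
s)^{n-2}`. It dominates `λ^ℓ ≤ (A l)^ℓ s^ℓ` because `2 s ≥ 1` and `n - 2 ≥ ℓ`. -/
lemma Scaling.flatnessCondition (h : Scaling k C₁ C₂ C₃ w₁ w₂ q l α E a κ η) {A : ℝ} (hA : 1 ≤ A)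
    (hαA : α ≤ A) (hC₁ : 0 < C₁) (hw₁ : w₁ ≠ 0) (hk : 2 ≤ k + 1)
    (hkn : ((k + 1 : ℕ) : ℤ) < (n : ℤ) - 2) {x₁ x₂ : ℝ} (hx₁ : 1 / 2 ≤ x₁) (hx₂ : 1 / 2 ≤ x₂)
    (u v : EuclideanSpace ℝ (Fin n)) :
    FlatnessCondition (k + 1) (A ^ (k + 1) * 2 ^ (n - 2) / C₁ / |w₁|) q
      (Param.mk (l * x₁) (α * l * x₂) u v) := by
  refine ⟨?_, hk, hkn⟩
  have hl := h.l_pos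
  have hα := h.α_pos
  have hq0 : 0 < ‖q‖ := norm_pos_iff.2 h.q_ne
  have hw : 0 < |w₁| := abs_pos.2 hw₁
  have hsα : 0 < √α := Real.sqrt_pos.2 hα
  have hsA : √α ≤ A := by
    rw [Real.sqrt_le_left (by linarith)]
    nlinarith
  have hx₁0 : 0 < x₁ := by linarith
  have hx₂0 : 0 < x₂ := by linarith
  rw [lam_mk_scaled hl hα]
  have hs : 1 / 2 ≤ √(x₁ * x₂) := (le_min hx₁ hx₂).trans (min_le_sqrt_mul hx₁0.le hx₂0.le)
  set s := √(x₁ * x₂)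
  have hs0 : 0 < s := by linarith
  obtain ⟨j, hj⟩ : ∃ j, n - 2 = (k + 1) + j := ⟨n - 2 - (k + 1), by omega⟩
  have e : (‖q‖ / (√α * l * s)) ^ (n - 2) * (E * s ^ (n - 2)) = 1 := by
    rw [← h.pow_eq, ← mul_pow, ← mul_pow]
    have : ‖q‖ / (√α * l * s) * (√α * l / ‖q‖ * s) = 1 := by field_simp
    rw [this, one_pow]
  have e2 : A ^ (k + 1) * 2 ^ (n - 2) / C₁ / |w₁| / (‖q‖ / (√α * l * s)) ^ (n - 2)
      = (A * l) ^ (k + 1) * (2 * s) ^ (n - 2) := by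
    rw [div_eq_iff (by positivity), ← mul_one (_ / _), ← e, ← h.abs_w₁_eq]
    field_simp
    ring
  rw [e2]
  have h1 : (√α * l * s) ^ (k + 1) ≤ (A * l) ^ (k + 1) * s ^ (k + 1) := by
    rw [mul_pow]; gcongr
  refine h1.trans (mul_le_mul_of_nonneg_left ?_ (by positivity))
  rw [hj, pow_add (2 * s)]
  have h2 : 1 ≤ (2 * s) ^ j := one_le_pow₀ (by linarith)
  have h3 : s ^ (k + 1) ≤ (2 * s) ^ (k + 1) := pow_le_pow_left₀ hs0.le (by linarith) _
  calc s ^ (k + 1) ≤ (2 * s) ^ (k + 1) := h3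
    _ ≤ _ := le_mul_of_one_le_right (by positivity) h2

end Ball

end TwinPeaks

end

/-! ### Choice of the constants and conclusion -/

theorem lemma5p21 (n ℓ : ℕ) (hℓ : 2 ≤ ℓ) (hℓn : (ℓ : ℤ) < (n : ℤ) - 2)
    (C₁ C₂ C₃ : ℝ) (hC₁ : 0 < C₁) (hC₂ : 0 < C₂) (hC₃ : 0 < C₃)
    (Cp : ℝ) (hCp : 0 < Cp)
    (Cbar cbar : ℝ) (hCbar : Cp ^ (1 / (ℓ : ℝ)) < Cbar) (hcbar : 0 < cbar) :
    ∃ Dbar μ₀ c K : ℝ, 0 < Dbar ∧ 0 < μ₀ ∧ 0 < c ∧ 0 < K ∧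
      ∀ (w₁ w₂ : ℝ) (q : EuclideanSpace ℝ (Fin n)),
        w₁ < 0 → w₂ < 0 → 1 / Cp * |w₁| ≤ |w₂| → |w₂| ≤ Cp * |w₁| → q ≠ 0 →
        Dbar ≤ TwinPeaks.DTau ℓ C₁ w₁ w₂ q →
        (TwinPeaks.PTau ℓ C₁ C₂ C₃ w₁ w₂ q ∈ TwinPeaks.domain n ∧
          TwinPeaks.modelMap ℓ C₁ C₂ C₃ w₁ w₂ q (TwinPeaks.PTau ℓ C₁ C₂ C₃ w₁ w₂ q) = 0 ∧
          ∀ P ∈ TwinPeaks.domain n, TwinPeaks.modelMap ℓ C₁ C₂ C₃ w₁ w₂ q P = 0 →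
            P = TwinPeaks.PTau ℓ C₁ C₂ C₃ w₁ w₂ q) ∧
        ∀ μ : ℝ, 0 < μ → μ ≤ μ₀ →
          Metric.closedBall (TwinPeaks.PTau ℓ C₁ C₂ C₃ w₁ w₂ q)
            (μ * TwinPeaks.lamTau₁ ℓ C₁ w₁ w₂ q) ⊆ TwinPeaks.domain n ∧
          TwinPeaks.brouwerDegree (TwinPeaks.modelMap ℓ C₁ C₂ C₃ w₁ w₂ q)
            (Metric.ball (TwinPeaks.PTau ℓ C₁ C₂ C₃ w₁ w₂ q)
              (μ * TwinPeaks.lamTau₁ ℓ C₁ w₁ w₂ q)) 0 = -1 ∧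
          (∀ P ∈ Metric.sphere (TwinPeaks.PTau ℓ C₁ C₂ C₃ w₁ w₂ q)
              (μ * TwinPeaks.lamTau₁ ℓ C₁ w₁ w₂ q),
            c * μ * |w₁| * TwinPeaks.lamTau ℓ C₁ w₁ w₂ q ^ ℓ
                ≤ ‖TwinPeaks.modelMap ℓ C₁ C₂ C₃ w₁ w₂ q P‖ ∧
            c * μ * |w₁| * P.lam ^ ℓ
                ≤ ‖TwinPeaks.modelMap ℓ C₁ C₂ C₃ w₁ w₂ q P‖) ∧
          ∀ P ∈ Metric.closedBall (TwinPeaks.PTau ℓ C₁ C₂ C₃ w₁ w₂ q)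
              (μ * TwinPeaks.lamTau₁ ℓ C₁ w₁ w₂ q),
            TwinPeaks.ScaleCondition Cbar cbar q P ∧
            TwinPeaks.FlatnessCondition ℓ (K / |w₁|) q P := by
  obtain ⟨k, rfl⟩ : ∃ k, ℓ = k + 1 := ⟨ℓ - 1, by omega⟩
  have hkn : k + 1 + 2 < n := by omega
  have hkn' : k + 1 < n - 2 := by omega
  -- For `Cp < 1` the comparability of `ϖ₁` and `ϖ₂` is contradictory, so any constants serve;
  -- otherwise `A = Cp^{1/ℓ} ≥ 1`.
  rcases lt_or_ge Cp 1 with hCp1 | hCp1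
  · refine ⟨1, 1, 1, 1, one_pos, one_pos, one_pos, one_pos, ?_⟩
    intro w₁ w₂ q hw₁ hw₂ h₁ h₂ hq hD
    exfalso
    have hw := abs_pos.2 hw₁.ne
    rw [one_div_mul_eq_div, div_le_iff₀ hCp] at h₁
    have := mul_lt_of_lt_one_left hw hCp1
    have := mul_le_of_le_one_right (abs_nonneg w₂) hCp1.le
    linarith
  set A : ℝ := Cp ^ (1 / ((k + 1 : ℕ) : ℝ)) with hA_def
  have hA : 1 ≤ A := Real.one_le_rpow hCp1 (by positivity)
  have hA0 : 0 < A := by linarith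
  have hsum : 0 < Cbar + A := by linarith
  set δ : ℝ := min (1 / 2) (min ((Cbar - A) / (2 * (Cbar + A))) (cbar / (8 * A))) with hδ_def
  have hδ0 : 0 < δ := lt_min (by norm_num)
    (lt_min (div_pos (by linarith) (by positivity)) (by positivity))
  have hδ : δ ≤ 1 / 2 := min_le_left _ _
  have hδC : A * (1 + δ) < Cbar * (1 - δ) := by
    have : δ ≤ (Cbar - A) / (2 * (Cbar + A)) := (min_le_right _ _).trans (min_le_left _ _)
    rw [le_div_iff₀ (by positivity)] at this
    nlinarith
  have hδc : 4 * A * δ < cbar := by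
    have : δ ≤ cbar / (8 * A) := (min_le_right _ _).trans (min_le_right _ _)
    rw [le_div_iff₀ (by positivity)] at this
    nlinarith
  clear_value δ
  obtain ⟨κ₀, B, hκ₀, hB, hbound⟩ :=
    TwinPeaks.exists_le_norm_scaledMap (n := n) hkn' (div_pos hC₂ hC₁) hA
  obtain ⟨Dbar, hDbar, hscal⟩ := TwinPeaks.exists_scaling hkn hC₁ hC₂ hC₃ hA hκ₀
    (div_pos hδ0 (pow_pos hA0 2))
  -- `μ₀ = δ / A` keeps all rescaled displacements below `δ`. In `c`, the factor `A * B` comes from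
  -- the lower bound on the sphere and `(2 * A) ^ (k + 1)` from comparing `l` with `λ_τ` and `λ`.
  refine ⟨Dbar, δ / A, C₁ / (A * B * (2 * A) ^ (k + 1)), A ^ (k + 1) * 2 ^ (n - 2) / C₁, hDbar,
    by positivity, by positivity, by positivity, ?_⟩
  intro w₁ w₂ q hw₁ hw₂ h₁ h₂ hq hD
  obtain ⟨hαA, hαA'⟩ := TwinPeaks.alpha_bounds (ℓ := k + 1) hCp hw₁ hw₂ h₁ h₂
  rw [← hA_def] at hαA hαA'
  obtain ⟨κ, η, h, hP, hκ, hκκ₀, hη, hκa⟩ := hscal w₁ w₂ q hw₁ hw₂ hq hαA hαA' hD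
  have hlam := TwinPeaks.lamTau_eq (ℓ := k + 1) hC₁ hw₁ hw₂ hq
  rw [hP, hlam]
  generalize TwinPeaks.alpha (k + 1) w₁ w₂ = α at *
  generalize TwinPeaks.lamTau₁ (k + 1) C₁ w₁ w₂ q = l at *
  have hl := h.l_pos
  have hα := h.α_pos
  have hw : 0 < |w₁| := abs_pos.2 hw₁.ne
  have hη' : A ^ 2 * ‖η‖ ≤ δ := by
    rwa [le_div_iff₀ (by positivity), mul_comm] at hη
  have hη1 : ‖η‖ ≤ 1 :=
    (le_mul_of_one_le_left (norm_nonneg _) (one_le_pow₀ hA)).trans (hη'.trans (by linarith))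
  have huniq : ∀ P ∈ TwinPeaks.domain n, TwinPeaks.modelMap (k + 1) C₁ C₂ C₃ w₁ w₂ q P = 0 →
      P = TwinPeaks.centre q l α η := fun P hPd hP0 => h.eq_centre hkn' (fun y₁ y₂ => by
    simpa using hbound κ α η 1 1 y₁ y₂ hκ hκκ₀ hα hαA hη1 (by norm_num) (by norm_num)
      (by norm_num) (by norm_num)) hPd hP0
  have hsα : √α ≤ A := by
    rw [Real.sqrt_le_left hA0.le]
    nlinarith
  refine ⟨⟨h.centre_mem, h.modelMap_centre, huniq⟩, ?_⟩
  intro μ hμ hμ₀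
  have hμδ : A * μ ≤ δ := by
    rwa [le_div_iff₀ hA0, mul_comm] at hμ₀
  have hball : Metric.closedBall (TwinPeaks.centre q l α η) (μ * l) ⊆ TwinPeaks.domain n := by
    intro P hPb
    rw [mem_closedBall_iff_norm] at hPb
    obtain ⟨x₁, x₂, y₁, y₂, rfl, -, hx₁, hx₂, -, -⟩ :=
      TwinPeaks.exists_scaled_coordinates_of_norm_sub_le hl hα hA hαA' hμδ hPb
    rw [abs_le] at hx₁ hx₂
    exact ⟨mul_pos hl (by linarith), mul_pos (mul_pos hα hl) (by linarith)⟩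
  refine ⟨hball, TwinPeaks.brouwerDegree_ball_eq_neg_one (mul_pos hμ hl) hball
    (TwinPeaks.contDiffOn_modelMap _ _ _ _ _ _ _) h.modelMap_centre huniq
    (h.det_fderiv_neg hkn' (div_pos hC₂ hC₁) hκa), ?_, ?_⟩
  · intro P hPs
    rw [mem_sphere_iff_norm] at hPs
    obtain ⟨x₁, x₂, y₁, y₂, rfl, hsub, hx₁, hx₂, -, -⟩ :=
      TwinPeaks.exists_scaled_coordinates_of_norm_sub_le hl hα hA hαA' hμδ hPs.le
    have hx₁' := abs_le.1 hx₁
    have hx₂' := abs_le.1 hx₂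
    have hx₁0 : 0 < x₁ := by linarith
    have hx₂0 : 0 < x₂ := by linarith
    have hS := hbound κ α η x₁ x₂ y₁ y₂ hκ hκκ₀ hα hαA hη1 (by linarith) (by linarith)
      (by linarith) (by linarith)
    rw [hsub] at hPs
    have hμS : μ ≤ A * B * ‖TwinPeaks.scaledMap k (C₂ / C₁) κ α η x₁ x₂ y₁ y₂‖ := by
      have e1 := TwinPeaks.Param.norm_mk_le (l * (x₁ - 1)) (α * l * (x₂ - 1)) (l • y₁) (l • y₂)
      rw [hPs, abs_mul, abs_mul, norm_smul, norm_smul, Real.norm_of_nonneg hl.le, abs_of_pos hl,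
        abs_of_pos (mul_pos hα hl)] at e1
      have e2 : μ * l ≤ (A * (|x₁ - 1| + |x₂ - 1| + ‖y₁‖ + ‖y₂‖)) * l := by
        refine e1.trans ?_
        have g1 : |x₁ - 1| ≤ A * |x₁ - 1| := le_mul_of_one_le_left (abs_nonneg _) hA
        have g2 : α * |x₂ - 1| ≤ A * |x₂ - 1| := mul_le_mul_of_nonneg_right hαA (abs_nonneg _)
        have g3 : ‖y₁‖ ≤ A * ‖y₁‖ := le_mul_of_one_le_left (norm_nonneg _) hA
        have g4 : ‖y₂‖ ≤ A * ‖y₂‖ := le_mul_of_one_le_left (norm_nonneg _) hA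
        have := mul_le_mul_of_nonneg_left (add_le_add (add_le_add (add_le_add g1 g2) g3) g4) hl.le
        linarith
      rw [mul_assoc]
      exact (le_of_mul_le_mul_right e2 hl).trans (mul_le_mul_of_nonneg_left hS hA0.le)
    rw [h.modelMap_eq hx₁0 hx₂0, norm_smul, Real.norm_of_nonneg h.E_pos.le,
      TwinPeaks.lam_mk_scaled hl hα]
    have hs : √(x₁ * x₂) ≤ 2 :=
      (TwinPeaks.sqrt_mul_le_max hx₁0.le hx₂0.le).trans (max_le (by linarith) (by linarith))
    -- Both `λ_τ = √α l` and `λ = √α l s` are at most `2 A l`, as `s ≤ 2`; one estimate serves for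
    -- the two bounds.
    have key : ∀ t : ℝ, 0 ≤ t → t ≤ 2 * A * l →
        C₁ / (A * B * (2 * A) ^ (k + 1)) * μ * |w₁| * t ^ (k + 1) ≤
          C₁ * |w₁| * l ^ (k + 1) * ‖TwinPeaks.scaledMap k (C₂ / C₁) κ α η x₁ x₂ y₁ y₂‖ := by
      intro t ht0 ht
      have f1 : t ^ (k + 1) ≤ (2 * A * l) ^ (k + 1) := pow_le_pow_left₀ ht0 ht _
      calc _ ≤ C₁ / (A * B * (2 * A) ^ (k + 1)) *
            (A * B * ‖TwinPeaks.scaledMap k (C₂ / C₁) κ α η x₁ x₂ y₁ y₂‖) * |w₁|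
              * (2 * A * l) ^ (k + 1) := by gcongr
        _ = _ := by
          rw [mul_pow (2 * A)]
          field_simp
    refine ⟨key _ (by positivity) ?_, key _ (by positivity) ?_⟩
    · linarith [mul_le_mul_of_nonneg_right hsα hl.le, mul_pos hA0 hl]
    · have g1 := mul_le_mul_of_nonneg_right hsα hl.le
      have g2 := mul_le_mul g1 hs (Real.sqrt_nonneg _) (by positivity)
      linarith
  · intro P hPb
    rw [mem_closedBall_iff_norm] at hPb
    obtain ⟨x₁, x₂, y₁, y₂, rfl, -, hx₁, hx₂, hy₁, hy₂⟩ :=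
      TwinPeaks.exists_scaled_coordinates_of_norm_sub_le hl hα hA hαA' hμδ hPb
    have hx₁' := abs_le.1 hx₁
    have hx₂' := abs_le.1 hx₂
    exact ⟨TwinPeaks.scaleCondition_mk_scaled hl hα hA hαA hαA' hδ hδC hδc hη' hx₁ hx₂ hy₁ hy₂,
      h.flatnessCondition hA hαA hC₁ hw₁.ne hℓ hℓn (by linarith) (by linarith) _ _⟩
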